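/- Let $N\ge 1$, let $K$ be a field of characteristic zero and let $\alpha\in K$ satisfy $m\alpha+n\neq 0$ for all integers $m\ge 1$, $n\ge 0$ (that is, $\alpha$ is neither zero nor a negative rational number; for instance $\alpha>0$ real, or $\alpha$ an indeterminate). For a composition $\eta\in\mathbb{Z}_{\ge 0}^N$ put $$\bar\eta_i=\alpha\eta_i-\#\{k<i:\eta_k\ge\eta_i\}-\#\{k>i:\eta_k>\eta_i\},$$ and let $s_{ip}$ be the operator exchanging $z_i$ and $z_p$. For every $\eta$ there is exactly one polynomial $E_\eta\in K[z_1,\dots,z_N]$ (the non-symmetric Jack polynomial) in which $z^\eta$ has coefficient $1$ and which satisfies $\xi_iE_\eta=\bar\eta_iE_\eta$ for $i=1,\dots,N$, where $$\xi_i=\alpha z_i\frac{\partial}{\partial z_i}+\sum_{p<i}\frac{z_i}{z_i-z_p}(1-s_{ip})+\sum_{p>i}\frac{z_p}{z_i-z_p}(1-s_{ip})+1-i .$$ Notation. Let $$d'_\eta=\prod_{i=1}^{N}\prod_{j=1}^{\eta_i}\bigl(\alpha(\eta_i-j+1)+l(i,j)\bigr),\qquad l(i,j)=\#\{k<i: j\le\eta_k+1\le\eta_i\}+\#\{k>i:j\le\eta_k\le\eta_i\},$$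 and, with $\eta^+$ the decreasing rearrangement of $\eta$ and $(v)_k=v(v+1)\cdots(v+k-1)=\Gamma(v+k)/\Gamma(v)$, $$e'_\eta=\alpha^{|\eta|}\prod_{j=1}^N\Bigl(1+\tfrac{N-1}{\alpha}-\tfrac{j-1}{\alpha}\Bigr)_{\eta_j^+}.$$ For a nonempty $I=\{t_1<\dots<t_s\}\subseteq\{1,\dots,N\}$ the composition $\nu=c_I(\eta)$ is given by $\nu_{t_j}=\eta_{t_{j+1}}$ $(1\le j\le s-1)$, $\nu_{t_s}=\eta_{t_1}+1$, $\nu_i=\eta_i$ $(i\notin I)$. With $t_0=0$, $I$ is called maximal with respect to $\eta$, written $I\in\mathbb{J}_\eta$, if $\eta_j\ne\eta_{t_u}$ for $t_{u-1}<j<t_u$, $u=1,\dots,s$, and $\eta_j\neq\eta_{t_1}+1$ for $j>t_s$. With $a(x,y)=\frac{1}{\alpha(x-y)}$ and $b(x,y)=\frac{x-y-1/\alpha}{x-y}$ put $$A_I(x)=\Bigl(\prod_{u=1}^{s-1}a(x_{t_u},x_{t_{u+1}})\Bigr)a(x_{t_s}-1,x_{t_1}),\qquad \hat B_I(x)=\Bigl(\prod_{u=1}^s\prod_{j=t_{u-1}+1}^{t_u-1}b(x_{t_u},x_j)\Bigr)\prod_{j=t_s+1}^N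 b(x_{t_1}+1,x_j),$$ $$\tilde B_I(x)=\hat B_I(x)\,\bigl(x_{t_1}+1+\tfrac{N-1}{\alpha}\bigr),$$ and, for $i\in I$, $\tilde\chi^{(i)}_I(x)=\alpha(x_i-x_{t_{k+1}})$ if $i=t_k$ with $k<s$, and $\tilde\chi^{(i)}_I(x)=\alpha(x_i-x_{t_1}-1)$ if $i=t_s$. Theorem. Let $\eta$ be a composition, and evaluate $\tilde\chi_I^{(i)},A_I,\hat B_I,\tilde B_I$ at $x=\bar\eta/\alpha=(\bar\eta_1/\alpha,\dots,\bar\eta_N/\alpha)$. (1) For $i=1,\dots,N$, $$z_iE_\eta=\frac{d'_\eta}{e'_\eta}\sum_{I\in\mathbb{J}_\eta,\ i\in I}\frac{e'_{c_I(\eta)}\,\tilde\chi_I^{(i)}A_I\hat B_I}{d'_{c_I(\eta)}}\,E_{c_I(\eta)} .$$ (2) For $I\in\mathbb{J}_\eta$ one has $\hat B_I=\alpha\,(e'_\eta/e'_{c_I(\eta)})\,\tilde B_I$, and for $i=1,\dots,N$ $$z_iE_\eta=\alpha d'_\eta\sum_{I\in\mathbb{J}_\eta,\ i\in I}\frac{\tilde\chi_I^{(i)}A_I\tilde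 B_I}{d'_{c_I(\eta)}}\,E_{c_I(\eta)} .$$ (3) If $z_jE_\eta=\sum_\nu c^{(j)}_{\eta,\nu}E_\nu$ is any expression as a finite linear combination, then for all $I\in\mathbb{J}_\eta$ with $j\in I$, writing $\nu=c_I(\eta)$, $$c^{(j)}_{\eta,\nu}=\frac{d'_\eta e'_\nu}{d'_\nu e'_\eta}\,\tilde\chi_I^{(j)}A_I\hat B_I,\qquad\text{equivalently}\qquad \frac{d'_\nu e'_\eta}{d'_\eta e'_\nu}\,c^{(j)}_{\eta,\nu}=\tilde\chi_I^{(j)}A_I\hat B_I,$$ and $c^{(j)}_{\eta,\nu}=0$ for every $\nu$ that is not of the form $c_I(\eta)$ with $I\in\mathbb{J}_\eta$, $j\in I$. (4) (Pieri formula for $p=1$.) $$\Bigl(\sum_{i=1}^Nz_i\Bigr)E_\eta=-\alpha^2d'_\eta\sum_{I\in\mathbb{J}_\eta}\frac{A_I\tilde B_I}{d'_{c_I(\eta)}}\,E_{c_I(\eta)} .$$ -/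

import Mathlib

open Finset MvPolynomial

namespace NonsymJack

noncomputable section Polynomials

variable {K : Type*} [Field K] {N : ℕ}

/-- The eigenvalue `η̄ᵢ = α ηᵢ - #{k < i | ηₖ ≥ ηᵢ} - #{k > i | ηₖ > ηᵢ}`. -/
def etaBar (α : K) (η : Fin N → ℕ) (i : Fin N) : K :=
  α * (η i : K) - (#{k : Fin N | k < i ∧ η i ≤ η k} : K) - (#{k : Fin N | i < k ∧ η i < η k} : K)

/-- A polynomial in `z₁, …, z_N` regarded as a rational function. -/
abbrev toRat (f : MvPolynomial (Fin N) K) : FractionRing (MvPolynomial (Fin N) K) :=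
  algebraMap (MvPolynomial (Fin N) K) (FractionRing (MvPolynomial (Fin N) K)) f

/-- The operator
`ξᵢ = α zᵢ ∂/∂zᵢ + ∑_{p<i} zᵢ/(zᵢ - z_p) (1 - s_{ip}) + ∑_{p>i} z_p/(zᵢ - z_p) (1 - s_{ip}) + 1 - i`
applied to a polynomial, the result being read in the field of rational functions.
The indices of `Fin N` start at `0`, so that `1 - i` becomes `-i`. -/
def xi (α : K) (i : Fin N) (f : MvPolynomial (Fin N) K) :
    FractionRing (MvPolynomial (Fin N) K) :=
  toRat (C α * X i * pderiv i f)
    + ∑ p ∈ Iio i, toRat (X i) / (toRat (X i) - toRat (X p)) *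
        toRat (f - rename (Equiv.swap i p) f)
    + ∑ p ∈ Ioi i, toRat (X p) / (toRat (X i) - toRat (X p)) *
        toRat (f - rename (Equiv.swap i p) f)
    - toRat (C ((i : ℕ) : K) * f)

/-- `E` is a simultaneous polynomial eigenfunction of the `ξᵢ` with eigenvalues `η̄ᵢ`, in which
the monomial `z^η` has coefficient one. -/
def IsNonsymJack (α : K) (η : Fin N → ℕ) (E : MvPolynomial (Fin N) K) : Prop :=
  (∀ i : Fin N, xi α i E = toRat (C (etaBar α η i) * E)) ∧
    E.coeff (Finsupp.equivFunOnFinite.symm η) = 1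

/-- The non-symmetric Jack polynomial `E_η`: the polynomial that satisfies `IsNonsymJack α η`. -/
def jackE (α : K) (η : Fin N → ℕ) : MvPolynomial (Fin N) K :=
  Classical.epsilon (IsNonsymJack α η)

/-- The leg length `l(i,j)` of the node `(i,j)` of `η` (columns `j` are numbered from `1`). -/
def leg (η : Fin N → ℕ) (i : Fin N) (j : ℕ) : ℕ :=
  #{k : Fin N | k < i ∧ j ≤ η k + 1 ∧ η k + 1 ≤ η i} + #{k : Fin N | i < k ∧ j ≤ η k ∧ η k ≤ η i}

/-- `d'_η = ∏_{(i,j) ∈ η} (α (a(i,j) + 1) + l(i,j))` with the arm length `a(i,j) = ηᵢ - j`. -/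
def dPrime (α : K) (η : Fin N → ℕ) : K :=
  ∏ i : Fin N, ∏ j ∈ Icc 1 (η i), (α * (((η i : K) - (j : K)) + 1) + (leg η i j : K))

/-- The decreasing rearrangement `η⁺` of `η`. -/
def etaPlus (η : Fin N → ℕ) : Fin N → ℕ := fun j => η (Tuple.sort η j.rev)

/-- `[u]_κ = ∏_{j=1}^N Γ(u - (j-1)/α + κ_j) / Γ(u - (j-1)/α)`, where a quotient
`Γ(v + k) / Γ(v)` with `k ∈ ℕ` is the product `v (v+1) ⋯ (v+k-1)`. -/
def genFactorial (α u : K) (κ : Fin N → ℕ) : K :=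
  ∏ j : Fin N, (ascPochhammer K (κ j)).eval (u - ((j : ℕ) : K) / α)

/-- `e'_η = α^{|η|} [1 + (N-1)/α]_{η⁺}`. -/
def ePrime (α : K) (η : Fin N → ℕ) : K :=
  α ^ (∑ i, η i) * genFactorial α (1 + ((N : K) - 1) / α) (etaPlus η)

end Polynomials

section Subsets

variable {N : ℕ} [NeZero N]

/-- The smallest element `t₁` of a nonempty set `I = {t₁ < ⋯ < t_s}`. -/
def first (I : Finset (Fin N)) : Fin N := if h : I.Nonempty then I.min' h else 0

/-- The largest element `t_s` of a nonempty set `I = {t₁ < ⋯ < t_s}`. -/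
def last (I : Finset (Fin N)) : Fin N := if h : I.Nonempty then I.max' h else 0

/-- The element `t_{u+1}` that follows `t = t_u` in `I = {t₁ < ⋯ < t_s}`, for `u < s`. -/
def next (I : Finset (Fin N)) (t : Fin N) : Fin N :=
  if h : (I.filter (t < ·)).Nonempty then (I.filter (t < ·)).min' h else t

/-- The positions `t_{u-1} + 1, …, t_u - 1` for `t = t_u ∈ I`; when `u = 1` they are the
positions to the left of `t₁`. -/
def gapBelow (I : Finset (Fin N)) (t : Fin N) : Finset (Fin N) :=
  (Iio t).filter fun j => ∀ k ∈ I, k < t → k < j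

/-- The composition `c_I(η)`. -/
def cI (I : Finset (Fin N)) (η : Fin N → ℕ) : Fin N → ℕ := fun i =>
  if i ∈ I then (if i = last I then η (first I) + 1 else η (next I i)) else η i

/-- `I` is maximal with respect to `η`. -/
def IsMaximal (η : Fin N → ℕ) (I : Finset (Fin N)) : Prop :=
  I.Nonempty ∧ (∀ t ∈ I, ∀ j ∈ gapBelow I t, η j ≠ η t) ∧
    ∀ j ∈ Ioi (last I), η j ≠ η (first I) + 1

instance (η : Fin N → ℕ) : DecidablePred (IsMaximal η) := fun I => by
  unfold IsMaximal; infer_instance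

/-- The set `𝕁_η` of all subsets that are maximal with respect to `η`. -/
def maximalSets (η : Fin N → ℕ) : Finset (Finset (Fin N)) := {I | IsMaximal η I}

end Subsets

noncomputable section Coefficients

variable {K : Type*} [Field K] {N : ℕ} [NeZero N]

/-- `a(x,y) = 1 / (α (x - y))`. -/
def fa (α x y : K) : K := 1 / (α * (x - y))

/-- `b(x,y) = (x - y - 1/α) / (x - y)`. -/
def fb (α x y : K) : K := (x - y - 1 / α) / (x - y)

/-- `A_I(x) = (∏_{u=1}^{s-1} a(x_{t_u}, x_{t_{u+1}})) a(x_{t_s} - 1, x_{t_1})`. -/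
def AI (α : K) (I : Finset (Fin N)) (x : Fin N → K) : K :=
  (∏ t ∈ I.erase (last I), fa α (x t) (x (next I t))) * fa α (x (last I) - 1) (x (first I))

/-- `B̂_I(x) = (∏_{u=1}^s ∏_{j=t_{u-1}+1}^{t_u-1} b(x_{t_u}, x_j)) ∏_{j=t_s+1}^N b(x_{t_1}+1, x_j)`,
with `t₀ = 0`. -/
def BHat (α : K) (I : Finset (Fin N)) (x : Fin N → K) : K :=
  (∏ t ∈ I, ∏ j ∈ gapBelow I t, fb α (x t) (x j)) * ∏ j ∈ Ioi (last I), fb α (x (first I) + 1) (x j)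

/-- `B̃_I(x) = (∏_{u=1}^s ∏_{j=t_{u-1}+1}^{t_u-1} b(x_{t_u}, x_j))
(∏_{j=t_s+1}^N b(x_{t_1}+1, x_j)) (x_{t_1} + 1 + (N-1)/α)`, with `t₀ = 0`. -/
def BTilde (α : K) (I : Finset (Fin N)) (x : Fin N → K) : K :=
  (∏ t ∈ I, ∏ j ∈ gapBelow I t, fb α (x t) (x j)) *
    (∏ j ∈ Ioi (last I), fb α (x (first I) + 1) (x j)) * (x (first I) + 1 + ((N : K) - 1) / α)

/-- `χ̃_I^{(i)}(x)` for `i ∈ I`: it is `α (x_i - x_{t_{k+1}})` for `i = t_k` with `k < s`, and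
`α (x_i - x_{t_1} - 1)` for `i = t_s`. -/
def chiTilde (α : K) (I : Finset (Fin N)) (i : Fin N) (x : Fin N → K) : K :=
  if i = last I then α * (x i - x (first I) - 1) else α * (x i - x (next I i))

end Coefficients

end NonsymJack

/-! The eigenvalues are `η̄ᵢ = α ηᵢ - rk η i`, where the rank counts the positions preceding `i` in
the decreasing rearrangement of `η`. Under the hypothesis on `α` the entries of `η̄` are distinct
and `η̄` determines `η`. Each `ξᵢ` is triangular on monomials with diagonal entry `η̄ᵢ`, so a joint
eigenfunction with eigenvalues `η̄` is fixed by its coefficient at `z^η`. Two intertwiners then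
produce all the `E_η`: an adjacent transposition mixes `E_η` with the Jack polynomial of the
exchanged composition, and the raising operator `Φ f = z_N f(z_N, z₁, …, z_{N-1})` sends `E_η` to
`E_{Φη}` with `Φη = (η₂, …, η_N, η₁ + 1)`.

The normalization `jackN = (e'_η / d'_η) E_η` makes both actions uniform (`raise_jackN`,
`swap_jackN`): `Φ` has coefficient `1`, and `s` acts by `δ⁻¹` on the polynomial itself and by `1 +
δ⁻¹` on the exchanged one, with `δ = η̄ᵢ - η̄ᵢ₊₁`; the second term is absent when the two entries
agree.

Now `z_N f = Φ(w f)` for the cycle `w`, a product of adjacent transpositions. Applying these one by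
one (`sweep`) carries an entry to the left. At each position it either passes the entry met there
(position outside `I`, weight `b`) or is dropped in exchange for it (position in `I`, weight `a`).
The final shift `Φ` turns the result into `c_I(η)`. A passed entry equal to the carried one has
weight zero, so only maximal `I` survive. For the other variables, `Φ` intertwines `zᵢ` with `zᵢ₋₁`,
and the weights are invariant under the shift (`hasExpansion`). The coefficient is a product over
all positions except `i`, that is, `A_I B̂_I` without the factor at `i`; this is what multiplication
by `χ̃` achieves.

Passing to `B̃_I` rests on writing `e'_η` as a product over positions of a function of `(ηᵢ,
η̄ᵢ/α)`: `c_I` permutes these pairs and raises just one of them. Coefficients are identified by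
linear independence of the `E_ν` and injectivity of `I ↦ c_I(η)` on maximal sets. The Pieri formula
holds because `∑ χ̃` telescopes to `-α`. -/

namespace NonsymJack

/-! ### Ranks in the decreasing rearrangement. -/

section Ranks

variable {N : ℕ}

/-- `k` precedes `i` in the decreasing rearrangement of `η`, ties being broken by position. -/
def Above (η : Fin N → ℕ) (k i : Fin N) : Prop := η i < η k ∨ (η i = η k ∧ k < i)

instance (η : Fin N → ℕ) (k i : Fin N) : Decidable (Above η k i) := by
  unfold Above; infer_instance

/-- The number of positions that precede `i` in the decreasing rearrangement of `η`. -/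
def rk (η : Fin N → ℕ) (i : Fin N) : ℕ := #{k : Fin N | Above η k i}

lemma Above.trans {η : Fin N → ℕ} {a b c : Fin N} (h : Above η a b) (h' : Above η b c) :
    Above η a c := by
  unfold Above at *; omega

lemma not_above_self (η : Fin N → ℕ) (a : Fin N) : ¬ Above η a a := by
  unfold Above; omega

lemma above_or_above (η : Fin N → ℕ) {a b : Fin N} (h : a ≠ b) : Above η a b ∨ Above η b a := by
  unfold Above; omega

lemma rk_lt_rk {η : Fin N → ℕ} {k i : Fin N} (h : Above η k i) : rk η k < rk η i := by
  apply Finset.card_lt_card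
  rw [Finset.ssubset_iff_of_subset]
  · exact ⟨k, by simpa using h, by simpa using not_above_self η k⟩
  · intro a ha
    simp only [mem_filter, mem_univ, true_and] at ha ⊢
    exact ha.trans h

lemma rk_lt (η : Fin N → ℕ) (i : Fin N) : rk η i < N := by
  have : rk η i < #(univ : Finset (Fin N)) := by
    apply Finset.card_lt_card
    rw [Finset.ssubset_univ_iff]
    intro h
    have := mem_univ i
    rw [← h] at this
    simp only [mem_filter, mem_univ, true_and] at this
    exact not_above_self η i this
  simpa using this

lemma rk_injective (η : Fin N → ℕ) : Function.Injective (rk η) := by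
  intro a b h
  by_contra hab
  rcases above_or_above η hab with h' | h' <;> have := rk_lt_rk h' <;> omega

lemma rk_comp_of_above {η ν : Fin N → ℕ} (e : Equiv.Perm (Fin N))
    (h : ∀ a b, Above ν a b ↔ Above η (e a) (e b)) (i : Fin N) : rk ν i = rk η (e i) := by
  unfold rk
  exact Finset.card_equiv e (by simp [h])

/-- Exchanging adjacent positions preserves the order of every pair except `i, j`, and that pair is
decided by its distinct values, so no tie is broken differently. -/
lemma above_swap {η : Fin N → ℕ} {i j : Fin N} (hij : (i : ℕ) + 1 = j) (h : η i ≠ η j)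
    (a b : Fin N) :
    Above (η ∘ Equiv.swap i j) a b ↔ Above η (Equiv.swap i j a) (Equiv.swap i j b) := by
  unfold Above
  simp only [Function.comp]
  by_cases hab : a = b
  · subst hab; simp
  rcases eq_or_ne a i with rfl | hai
  · rcases eq_or_ne b j with rfl | hbj
    · simp; omega
    · rw [Equiv.swap_apply_left, Equiv.swap_apply_of_ne_of_ne (Ne.symm hab) hbj]
      have : (b : ℕ) ≠ j := fun h => hbj (Fin.ext h)
      have : (b : ℕ) ≠ a := fun h => hab (Fin.ext h.symm)
      omega
  rcases eq_or_ne a j with rfl | haj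
  · rcases eq_or_ne b i with rfl | hbi
    · simp; omega
    · rw [Equiv.swap_apply_right, Equiv.swap_apply_of_ne_of_ne hbi (Ne.symm hab)]
      have : (b : ℕ) ≠ i := fun h => hbi (Fin.ext h)
      have : (b : ℕ) ≠ a := fun h => hab (Fin.ext h.symm)
      omega
  rw [Equiv.swap_apply_of_ne_of_ne hai haj]
  have : (a : ℕ) ≠ i := fun h => hai (Fin.ext h)
  have : (a : ℕ) ≠ j := fun h => haj (Fin.ext h)
  rcases eq_or_ne b i with rfl | hbi
  · rw [Equiv.swap_apply_left]; omega
  rcases eq_or_ne b j with rfl | hbj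
  · rw [Equiv.swap_apply_right]; omega
  rw [Equiv.swap_apply_of_ne_of_ne hbi hbj]

lemma rk_swap {η : Fin N → ℕ} {i j : Fin N} (hij : (i : ℕ) + 1 = j) (h : η i ≠ η j)
    (k : Fin N) : rk (η ∘ Equiv.swap i j) k = rk η (Equiv.swap i j k) :=
  rk_comp_of_above _ (above_swap hij h) k

lemma rk_succ_of_eq {η : Fin N → ℕ} {i j : Fin N} (hij : (i : ℕ) + 1 = j) (h : η i = η j) :
    rk η j = rk η i + 1 := by
  unfold rk
  rw [← Finset.card_insert_of_notMem (a := i) (by simp [not_above_self])]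
  congr 1
  ext a
  simp only [mem_filter, mem_univ, true_and, mem_insert]
  have : a = i ↔ (a : ℕ) = i := Fin.ext_iff
  rw [this]
  unfold Above
  by_cases h1 : (a : ℕ) = i
  · have h2 := this.2 h1
    subst h2; omega
  · omega

/-- The ranks, as a permutation. -/
noncomputable def rkEquiv (η : Fin N → ℕ) : Equiv.Perm (Fin N) :=
  Equiv.ofBijective (fun i => (⟨rk η i, rk_lt η i⟩ : Fin N)) <|
    Finite.injective_iff_bijective.1 fun _ _ h => rk_injective η (by simpa using h)

lemma coe_rkEquiv (η : Fin N → ℕ) (i : Fin N) : ((rkEquiv η i : Fin N) : ℕ) = rk η i := rfl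

/-- The permutation `Tuple.sort` need not agree with the ranks on its face, but two monotone
rearrangements of the same tuple are equal as functions. -/
lemma etaPlus_rkEquiv (η : Fin N → ℕ) (i : Fin N) : etaPlus η (rkEquiv η i) = η i := by
  have h1 : Monotone (η ∘ (Fin.revPerm.trans (rkEquiv η).symm)) := by
    intro a b hab
    by_contra hlt
    simp only [Function.comp, Equiv.trans_apply, Fin.revPerm_apply, not_le] at hlt
    have h3 := rk_lt_rk (η := η) (Or.inl hlt)
    rw [← coe_rkEquiv, ← coe_rkEquiv, Equiv.apply_symm_apply, Equiv.apply_symm_apply] at h3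
    simp only [Fin.val_rev] at h3
    have : (a : ℕ) ≤ b := hab
    omega
  have h := congrFun (Tuple.unique_monotone (Tuple.monotone_sort η) h1) (rkEquiv η i).rev
  simpa [etaPlus] using h

end Ranks

/-! ### The cyclic shift of positions and compositions. -/

section Rotation

variable {N : ℕ} [NeZero N]

/-- The cyclic permutation `i ↦ i + 1` of the positions. -/
def rot : Equiv.Perm (Fin N) := Equiv.addRight 1

lemma coe_rot (i : Fin N) : ((rot i : Fin N) : ℕ) = if (i : ℕ) + 1 = N then 0 else (i : ℕ) + 1 := by
  have hi := i.isLt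
  simp only [rot, Equiv.coe_addRight, Fin.val_add]
  rw [Fin.coe_ofNat_eq_mod, Nat.add_mod_mod]
  split_ifs with h
  · rw [h, Nat.mod_self]
  · exact Nat.mod_eq_of_lt (by omega)

lemma coe_zero' : ((0 : Fin N) : ℕ) = 0 := by simp

/-- The last position. -/
def top : Fin N := rot.symm 0

lemma rot_top : rot (top : Fin N) = 0 := by simp [top]

lemma coe_top : ((top : Fin N) : ℕ) + 1 = N := by
  have h := coe_rot (top : Fin N)
  rw [rot_top, coe_zero'] at h
  by_contra h'
  rw [if_neg h'] at h
  omega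

lemma rot_eq_zero_iff (i : Fin N) : rot i = 0 ↔ i = top := by
  rw [top, Equiv.eq_symm_apply]

/-- The composition `Φη = (η₂, …, η_N, η₁ + 1)`. -/
def phi (η : Fin N → ℕ) : Fin N → ℕ := fun i => η (rot i) + if rot i = 0 then 1 else 0

/-- In first position an entry wins all its ties. In last position it would lose them, and the added
one compensates exactly. -/
lemma above_phi (η : Fin N → ℕ) (a b : Fin N) :
    Above (phi η) a b ↔ Above η (rot a) (rot b) := by
  have ha := coe_rot a
  have hb := coe_rot b
  have h1 : rot a = 0 ↔ ((rot a : Fin N) : ℕ) = 0 := by rw [Fin.ext_iff, coe_zero']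
  have h2 : rot b = 0 ↔ ((rot b : Fin N) : ℕ) = 0 := by rw [Fin.ext_iff, coe_zero']
  have := a.isLt
  have := b.isLt
  unfold Above phi
  by_cases h3 : rot a = 0 <;> by_cases h4 : rot b = 0
  · have : rot a = rot b := h3.trans h4.symm
    have hab : a = b := rot.injective this
    subst hab; omega
  all_goals
    simp only [h3, h4, if_true, if_false, Fin.lt_def]
    rw [h1] at h3
    rw [h2] at h4
    try simp only [coe_zero']
    split_ifs at ha hb <;> omega

lemma rk_phi (η : Fin N → ℕ) (i : Fin N) : rk (phi η) i = rk η (rot i) :=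
  rk_comp_of_above _ (above_phi η) i

end Rotation

/-! ### The joint spectrum and its separation of compositions. -/

section Spectrum

variable {K : Type*} [Field K] {N : ℕ}

lemma etaBar_eq (α : K) (η : Fin N → ℕ) (i : Fin N) :
    etaBar α η i = α * η i - rk η i := by
  unfold etaBar rk
  rw [sub_sub, ← Nat.cast_add, ← Finset.card_union_of_disjoint]
  · congr 3
    ext k
    simp only [mem_union, mem_filter, mem_univ, true_and]
    unfold Above
    by_cases h : k = i
    · subst h; omega
    · have : (k : ℕ) ≠ i := fun h' => h (Fin.ext h')
      omega
  · rw [Finset.disjoint_left]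
    intro k
    simp only [mem_filter, mem_univ, true_and]
    omega

lemma etaBar_swap (α : K) {η : Fin N → ℕ} {i j : Fin N} (hij : (i : ℕ) + 1 = j)
    (h : η i ≠ η j) (k : Fin N) :
    etaBar α (η ∘ Equiv.swap i j) k = etaBar α η (Equiv.swap i j k) := by
  rw [etaBar_eq, etaBar_eq, rk_swap hij h, Function.comp]

lemma etaBar_of_eq (α : K) {η : Fin N → ℕ} {i j : Fin N} (hij : (i : ℕ) + 1 = j)
    (h : η i = η j) : etaBar α η i = etaBar α η j + 1 := by
  rw [etaBar_eq, etaBar_eq, rk_succ_of_eq hij h, h]; push_cast; ring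

lemma etaBar_phi [NeZero N] (α : K) (η : Fin N → ℕ) (i : Fin N) :
    etaBar α (phi η) i = etaBar α η (rot i) + if rot i = 0 then α else 0 := by
  rw [etaBar_eq, etaBar_eq, rk_phi, phi]
  split_ifs <;> push_cast <;> ring

variable [CharZero K] {α : K}

lemma ne_zero_of_generic (hα : ∀ m n : ℕ, 0 < m → (m : K) * α + (n : K) ≠ 0) : α ≠ 0 := by
  simpa using hα 1 0 one_pos

/-- An integer combination `p α + q` with `p, q ≥ 0`, not both zero, does not vanish. -/
lemma generic_int (hα : ∀ m n : ℕ, 0 < m → (m : K) * α + (n : K) ≠ 0) {p q : ℤ} (hp : 0 ≤ p)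
    (hq : 0 ≤ q) (h : p ≠ 0 ∨ q ≠ 0) : (p : K) * α + q ≠ 0 := by
  lift p to ℕ using hp
  lift q to ℕ using hq
  rcases Nat.eq_zero_or_pos p with rfl | hp
  · simpa using h
  · simpa using hα p q hp

/-- Larger entries have smaller ranks, so up to sign the difference is `p α + q` with `p, q ≥ 0` not
both zero; `k ≤ i` settles the ties. This keeps the denominator of `A_I` at the last element of `I`
nonzero. -/
lemma etaBar_ne_add (hα : ∀ m n : ℕ, 0 < m → (m : K) * α + (n : K) ≠ 0) (η : Fin N → ℕ)
    {k i : Fin N} (h : k ≤ i) : etaBar α η i ≠ etaBar α η k + α := by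
  intro h'
  rw [etaBar_eq, etaBar_eq] at h'
  rcases Nat.lt_or_ge (η k) (η i) with hlt | hge
  · have hr := rk_lt_rk (η := η) (Or.inl hlt : Above η i k)
    apply generic_int hα (p := (η i : ℤ) - η k - 1) (q := rk η k - rk η i) (by omega) (by omega)
      (by omega)
    push_cast
    linear_combination h'
  · have hr : rk η k ≤ rk η i := by
      rcases eq_or_ne k i with rfl | hki
      · rfl
      · apply (rk_lt_rk (η := η) _).le
        unfold Above
        have : (k : ℕ) ≠ i := fun h' => hki (Fin.ext h')
        omega
    apply generic_int hα (p := (η k : ℤ) + 1 - η i) (q := rk η i - rk η k) (by omega) (by omega)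
      (by omega)
    push_cast
    linear_combination - h'

lemma etaBar_injective (hα : ∀ m n : ℕ, 0 < m → (m : K) * α + (n : K) ≠ 0) (η : Fin N → ℕ) :
    Function.Injective (etaBar α η) := by
  intro i k h
  by_contra hik
  wlog hab : Above η i k generalizing i k
  · exact this h.symm (Ne.symm hik) ((above_or_above η hik).resolve_left hab)
  have hr := rk_lt_rk hab
  rw [etaBar_eq, etaBar_eq] at h
  have : η k ≤ η i := by unfold Above at hab; omega
  apply generic_int hα (p := (η i : ℤ) - η k) (q := rk η k - rk η i) (by omega) (by omega)
      (by omega)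
  push_cast
  linear_combination h

/-- Among the positions with `ν i < η i`, take the one of least rank in `η`. Equality of eigenvalues
makes its rank in `ν` strictly smaller, so some `k` precedes it in `η` but not in `ν`. Then `ν k < η
k` and `k` has smaller rank, a contradiction. -/
lemma le_of_etaBar_eq (hα : ∀ m n : ℕ, 0 < m → (m : K) * α + (n : K) ≠ 0) {η ν : Fin N → ℕ}
    (h : ∀ i, etaBar α η i = etaBar α ν i) (i : Fin N) : η i ≤ ν i := by
  by_contra! hi
  obtain ⟨i, hi, hmin⟩ : ∃ i, ν i < η i ∧ ∀ k, ν k < η k → rk η i ≤ rk η k := by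
    obtain ⟨i, hi, hmin⟩ := Finset.exists_min_image ({i | ν i < η i} : Finset (Fin N)) (rk η)
      ⟨i, by simpa using hi⟩
    exact ⟨i, by simpa using hi, fun k hk => hmin k (by simpa using hk)⟩
  have hlt : rk ν i < rk η i := by
    by_contra! hle
    have h' := h i
    rw [etaBar_eq, etaBar_eq] at h'
    apply generic_int hα (p := (η i : ℤ) - ν i) (q := rk ν i - rk η i) (by omega) (by omega)
      (by omega)
    push_cast
    linear_combination h'
  obtain ⟨k, hk, hk'⟩ : ∃ k, Above η k i ∧ ¬ Above ν k i := by
    by_contra! hsub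
    refine absurd (Finset.card_le_card (s := {k | Above η k i}) (t := {k | Above ν k i}) ?_)
      (not_le.2 hlt)
    intro k hk
    simpa using hsub k (by simpa using hk)
  have h1 := rk_lt_rk hk
  have h2 := hmin k (by unfold Above at hk hk'; omega)
  omega

lemma eq_of_etaBar_eq (hα : ∀ m n : ℕ, 0 < m → (m : K) * α + (n : K) ≠ 0) {η ν : Fin N → ℕ}
    (h : ∀ i, etaBar α η i = etaBar α ν i) : η = ν :=
  funext fun i => le_antisymm (le_of_etaBar_eq hα h i) (le_of_etaBar_eq hα (fun i => (h i).symm) i)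

end Spectrum

/-! ### Triangularity of the operators on monomials. -/

section Triangularity

variable {K : Type*} [Field K] {N : ℕ}

/-- The monomial `z^η`. -/
noncomputable def mon (K : Type*) [Field K] (η : Fin N → ℕ) : MvPolynomial (Fin N) K :=
  monomial (Finsupp.equivFunOnFinite.symm η) 1

/-- The coefficient of `z^η` in `f`. -/
noncomputable def co (η : Fin N → ℕ) : MvPolynomial (Fin N) K →ₗ[K] K :=
  lcoeff K (Finsupp.equivFunOnFinite.symm η)

lemma co_mon (η ν : Fin N → ℕ) : co ν (mon K η) = if ν = η then 1 else 0 := by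
  simp [co, mon, lcoeff, coeff_monomial, eq_comm]

lemma co_C_mul (η : Fin N → ℕ) (c : K) (f : MvPolynomial (Fin N) K) :
    co η (C c * f) = c * co η f := by
  simp [co, lcoeff]

lemma exists_co_ne_zero {f : MvPolynomial (Fin N) K} (hf : f ≠ 0) : ∃ η, co η f ≠ 0 := by
  obtain ⟨d, hd⟩ := MvPolynomial.ne_zero_iff.1 hf
  exact ⟨d, by simpa [co, lcoeff] using hd⟩

lemma finite_co_ne_zero (f : MvPolynomial (Fin N) K) : {η | co η f ≠ 0}.Finite := by
  refine (Set.Finite.image (fun d : Fin N →₀ ℕ => (d : Fin N → ℕ))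
    (Finset.finite_toSet f.support)).subset ?_
  intro η h
  exact ⟨Finsupp.equivFunOnFinite.symm η, by simpa [co, lcoeff] using h, by simp⟩

/-- The compositions whose monomials occur in `f`. -/
noncomputable def compSupport (f : MvPolynomial (Fin N) K) : Finset (Fin N → ℕ) :=
  (finite_co_ne_zero f).toFinset

lemma mem_compSupport {f : MvPolynomial (Fin N) K} {η : Fin N → ℕ} :
    η ∈ compSupport f ↔ co η f ≠ 0 := by simp [compSupport]

lemma ext_co {f g : MvPolynomial (Fin N) K} (h : ∀ η, co η f = co η g) : f = g := by
  by_contra hne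
  obtain ⟨η, hη⟩ := exists_co_ne_zero (sub_ne_zero.2 hne)
  exact hη (by rw [map_sub, h, sub_self])

lemma eq_sum_mon (f : MvPolynomial (Fin N) K) :
    f = ∑ η ∈ compSupport f, C (co η f) * mon K η := by
  apply ext_co
  intro ν
  rw [map_sum]
  simp only [co_C_mul, co_mon, mul_ite, mul_one, mul_zero, Finset.sum_ite_eq]
  split_ifs with h
  · rfl
  · simpa [mem_compSupport] using h

lemma rename_mon (w : Equiv.Perm (Fin N)) (η : Fin N → ℕ) :
    rename w (mon K η) = mon K (η ∘ w.symm) := by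
  rw [mon, rename_monomial, mon]
  refine congrArg (fun d => monomial d (1 : K)) (Finsupp.ext fun i => ?_)
  rw [← Equiv.apply_symm_apply w i, Finsupp.mapDomain_apply w.injective]
  simp

lemma co_rename (w : Equiv.Perm (Fin N)) (f : MvPolynomial (Fin N) K) (η : Fin N → ℕ) :
    co η (rename w f) = co (η ∘ w) f := by
  have h := coeff_rename_mapDomain w w.injective f (Finsupp.equivFunOnFinite.symm (η ∘ w))
  simp only [co, lcoeff]
  rw [LinearMap.coe_mk, AddHom.coe_mk, LinearMap.coe_mk, AddHom.coe_mk, ← h]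
  congr 1
  ext i
  rw [← Equiv.apply_symm_apply w i, Finsupp.mapDomain_apply w.injective]
  simp

lemma X_mul_mon (i : Fin N) (η : Fin N → ℕ) :
    X i * mon K η = mon K (Function.update η i (η i + 1)) := by
  rw [mon, X, monomial_mul, mon, one_mul]
  refine congrArg (fun d => monomial d (1 : K)) (Finsupp.ext fun j => ?_)
  by_cases h : j = i
  · subst h; simp [add_comm]
  · simp [h]

lemma X_mul_pderiv_mon (i : Fin N) (η : Fin N → ℕ) :
    X i * pderiv i (mon K η) = C (η i : K) * mon K η := by
  rw [mon, X_mul_pderiv_monomial]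
  rw [C_mul_monomial]
  simp [smul_monomial]

/-- A statistic that decreases from `η` to the other monomials of `ξᵢ z^η`. -/
def rho (η : Fin N → ℕ) : ℕ ×ₗ ℕ := toLex (∑ i, η i ^ 2, ∑ i, η i * (N - i))

lemma sum_update_update {M : Type*} [AddCommMonoid M] (F : Fin N → ℕ → M) (η : Fin N → ℕ)
    {i p : Fin N} (h : i ≠ p) (a b : ℕ) :
    ∑ j, F j (Function.update (Function.update η i a) p b j) + (F i (η i) + F p (η p)) =
      ∑ j, F j (η j) + (F i a + F p b) := by
  rw [← Finset.add_sum_erase _ _ (mem_univ i), ← Finset.add_sum_erase univ (fun j => F j (η j))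
    (mem_univ i), ← Finset.add_sum_erase (univ.erase i) _ (mem_erase.2 ⟨h.symm, mem_univ p⟩),
    ← Finset.add_sum_erase (univ.erase i) (fun j => F j (η j)) (mem_erase.2 ⟨h.symm, mem_univ p⟩)]
  have : ∑ j ∈ (univ.erase i).erase p, F j (Function.update (Function.update η i a) p b j) =
      ∑ j ∈ (univ.erase i).erase p, F j (η j) := by
    apply Finset.sum_congr rfl
    intro j hj
    simp only [mem_erase] at hj
    simp [hj.1, hj.2.1]
  rw [this]
  simp [h]
  abel

/-- The composition obtained from `η` by moving to `i` and `p` the entries `η_p + k`, `η_i - k`. -/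
def transfer (i p : Fin N) (η : Fin N → ℕ) (k : ℕ) : Fin N → ℕ :=
  Function.update (Function.update η i (η p + k)) p (η i - k)

lemma transfer_zero (i p : Fin N) (η : Fin N → ℕ) :
    transfer i p η 0 = η ∘ Equiv.swap i p := by
  ext j
  simp only [transfer, Function.comp, Function.update_apply, Equiv.swap_apply_def, add_zero,
    tsub_zero]
  split_ifs <;> simp_all

lemma transfer_diff (i p : Fin N) (η : Fin N → ℕ) (h : η p ≤ η i) :
    transfer i p η (η i - η p) = η := by
  ext j
  simp only [transfer, Function.update_apply]
  split_ifs with h1 h2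
  · subst h1; omega
  · subst h2; omega
  · rfl

/-- Strict convexity of the square: two entries with fixed sum have smaller sum of squares when they
lie strictly between the original ones. -/
lemma rho_transfer_lt {i p : Fin N} (hip : i ≠ p) {η : Fin N → ℕ} {k : ℕ} (hk : 0 < k)
    (hk' : k < η i - η p) : rho (transfer i p η k) < rho η := by
  rw [rho, rho, Prod.Lex.toLex_lt_toLex]
  left
  have h := sum_update_update (fun _ m => m ^ 2) η hip (η p + k) (η i - k)
  simp only at h ⊢
  unfold transfer
  obtain ⟨m, hm⟩ : ∃ m, η i = η p + k + m := ⟨η i - η p - k, by omega⟩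
  have hm0 : 0 < m := by omega
  have e : η i - k = η p + m := by omega
  rw [e] at h ⊢
  rw [hm] at h
  nlinarith [Nat.mul_pos hk hm0]

/-- The sums of squares agree, and the second component decides: its weights decrease with the
position, so moving the larger entry to the right lowers it. -/
lemma rho_swap_lt {i p : Fin N} (hip : i < p) {η : Fin N → ℕ} (h : η p < η i) :
    rho (η ∘ Equiv.swap i p) < rho η := by
  rw [← transfer_zero, rho, rho, Prod.Lex.toLex_lt_toLex]
  right
  have h1 := sum_update_update (fun _ m => m ^ 2) η hip.ne (η p + 0) (η i - 0)
  have h2 := sum_update_update (fun (j : Fin N) m => m * (N - j)) η hip.ne (η p + 0) (η i - 0)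
  simp only at h1 h2 ⊢
  unfold transfer
  constructor
  · simp only [add_zero, tsub_zero] at h1 ⊢; omega
  · obtain ⟨m, hm⟩ : ∃ m, η i = η p + m := ⟨η i - η p, by omega⟩
    have hi : (i : ℕ) < p := hip
    have hp := p.isLt
    obtain ⟨q, hq⟩ : ∃ q, N - (i : ℕ) = (N - p) + q := ⟨p - i, by omega⟩
    have hm0 : 0 < m := by omega
    have hq0 : 0 < q := by omega
    simp only [add_zero, tsub_zero] at h2 ⊢
    rw [hq, hm] at h2
    rw [hm]
    nlinarith [Nat.mul_pos hm0 hq0]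

/-- `R` is `c z^η` up to monomials on which `rho` is smaller. -/
def Tri (R : MvPolynomial (Fin N) K) (η : Fin N → ℕ) (c : K) : Prop :=
  ∀ ν, rho η ≤ rho ν → co ν R = if ν = η then c else 0

lemma Tri.add {R R' : MvPolynomial (Fin N) K} {η : Fin N → ℕ} {c c' : K} (h : Tri R η c)
    (h' : Tri R' η c') : Tri (R + R') η (c + c') := by
  intro ν hν
  rw [map_add, h ν hν, h' ν hν]
  split_ifs <;> simp

lemma Tri.neg {R : MvPolynomial (Fin N) K} {η : Fin N → ℕ} {c : K} (h : Tri R η c) :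
    Tri (-R) η (-c) := by
  intro ν hν
  rw [map_neg, h ν hν]
  split_ifs <;> simp

lemma Tri.sum {ι : Type*} (s : Finset ι) {R : ι → MvPolynomial (Fin N) K} {η : Fin N → ℕ}
    {c : ι → K} (h : ∀ i ∈ s, Tri (R i) η (c i)) : Tri (∑ i ∈ s, R i) η (∑ i ∈ s, c i) := by
  intro ν hν
  rw [map_sum, Finset.sum_congr rfl fun i hi => h i hi ν hν]
  split_ifs <;> simp

lemma tri_mon_of_lt {μ η : Fin N → ℕ} (h : rho μ < rho η) : Tri (mon K μ) η 0 := by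
  intro ν hν
  rw [co_mon, if_neg, ite_self]
  rintro rfl
  exact absurd h (not_lt.2 hν)

lemma tri_C_mul_mon (c : K) (η : Fin N → ℕ) : Tri (C c * mon K η) η c := by
  intro ν _
  rw [co_C_mul, co_mon]
  split_ifs <;> simp

lemma toRat_injective : Function.Injective (toRat (K := K) (N := N)) :=
  IsFractionRing.injective (MvPolynomial (Fin N) K) (FractionRing (MvPolynomial (Fin N) K))

lemma toRat_X_sub_ne_zero {i p : Fin N} (h : i ≠ p) :
    toRat (K := K) (X i) - toRat (X p) ≠ 0 := by
  rw [sub_ne_zero]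
  intro h'
  exact h (X_injective (toRat_injective h'))

/-- The divided difference of a monomial is a geometric sum. Its products with `zᵢ` and `z_p` are
the transfers with `k` shifted by one, so their difference telescopes. -/
lemma sum_transfer (i p : Fin N) (hip : i ≠ p) (η : Fin N → ℕ) (h : η p ≤ η i) :
    ((X i - X p) * ∑ k ∈ range (η i - η p),
      mon K (Function.update (transfer i p η k) p (η i - (k + 1)))) =
      mon K η - rename (Equiv.swap i p) (mon K η) ∧
    X i * ∑ k ∈ range (η i - η p),
      mon K (Function.update (transfer i p η k) p (η i - (k + 1))) =
      ∑ k ∈ range (η i - η p), mon K (transfer i p η (k + 1)) ∧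
    X p * ∑ k ∈ range (η i - η p),
      mon K (Function.update (transfer i p η k) p (η i - (k + 1))) =
      ∑ k ∈ range (η i - η p), mon K (transfer i p η k) := by
  have h1 : X i * ∑ k ∈ range (η i - η p),
      mon K (Function.update (transfer i p η k) p (η i - (k + 1))) =
      ∑ k ∈ range (η i - η p), mon K (transfer i p η (k + 1)) := by
    rw [Finset.mul_sum]
    apply Finset.sum_congr rfl
    intro k _
    rw [X_mul_mon]
    congr 1
    ext j
    simp only [transfer, Function.update_apply]
    split_ifs <;> simp_all; omega
  have h2 : X p * ∑ k ∈ range (η i - η p),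
      mon K (Function.update (transfer i p η k) p (η i - (k + 1))) =
      ∑ k ∈ range (η i - η p), mon K (transfer i p η k) := by
    rw [Finset.mul_sum]
    apply Finset.sum_congr rfl
    intro k hk
    rw [Finset.mem_range] at hk
    rw [X_mul_mon]
    congr 1
    ext j
    simp only [transfer, Function.update_apply]
    split_ifs <;> simp_all
    omega
  refine ⟨?_, h1, h2⟩
  rw [sub_mul, h1, h2, ← Finset.sum_sub_distrib,
    Finset.sum_range_sub (fun k => mon K (transfer i p η k)), transfer_diff i p η h, transfer_zero,
    rename_mon, Equiv.symm_swap]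

/-- The last transfer, `k = η i - η p`, is `z^η` itself and gives the diagonal coefficient; the
earlier ones are smaller for `rho`. -/
lemma exists_tri_big {i p : Fin N} (hip : i ≠ p) {η : Fin N → ℕ} (h : η p ≤ η i) :
    ∃ R : MvPolynomial (Fin N) K, toRat R = toRat (X i) / (toRat (X i) - toRat (X p)) *
      toRat (mon K η - rename (Equiv.swap i p) (mon K η)) ∧
      Tri R η (if η p < η i then 1 else 0) := by
  obtain ⟨h0, h1, h2⟩ := sum_transfer (K := K) i p hip η h
  refine ⟨∑ k ∈ range (η i - η p), mon K (transfer i p η (k + 1)), ?_, ?_⟩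
  · rw [← h0, ← h1]
    have := toRat_X_sub_ne_zero (K := K) hip
    simp only [toRat, map_mul, map_sub] at this ⊢
    field_simp
  · obtain ⟨d, hd⟩ : ∃ d, d = η i - η p := ⟨_, rfl⟩
    rw [← hd]
    rcases d with _ | d
    · rw [if_neg (by omega)]
      intro ν _
      simp
    · rw [if_pos (by omega), Finset.sum_range_succ, hd, transfer_diff i p η h]
      have h3 := (Tri.sum (K := K) (range d) (c := fun _ => 0) fun k hk =>
        tri_mon_of_lt (rho_transfer_lt hip (η := η) (Nat.succ_pos k) (by
          rw [Finset.mem_range] at hk; omega))).add (tri_C_mul_mon 1 η)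
      simpa using h3

/-- Here the transfers start at `k = 0`, the exchanged monomial, and stop before `z^η`. The first
one is smaller for `rho` because `i < p`. -/
lemma exists_tri_small {i p : Fin N} (hip : i < p) {η : Fin N → ℕ} (h : η p ≤ η i) :
    ∃ R : MvPolynomial (Fin N) K, toRat R = toRat (X p) / (toRat (X i) - toRat (X p)) *
      toRat (mon K η - rename (Equiv.swap i p) (mon K η)) ∧ Tri R η 0 := by
  obtain ⟨h0, h1, h2⟩ := sum_transfer (K := K) i p hip.ne η h
  refine ⟨∑ k ∈ range (η i - η p), mon K (transfer i p η k), ?_, ?_⟩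
  · rw [← h0, ← h2]
    have := toRat_X_sub_ne_zero (K := K) hip.ne
    simp only [toRat, map_mul, map_sub] at this ⊢
    field_simp
  · have h3 := Tri.sum (K := K) (range (η i - η p)) (c := fun _ => 0)
      (R := fun k => mon K (transfer i p η k)) (η := η) fun k hk => ?_
    · simpa using h3
    · rw [Finset.mem_range] at hk
      apply tri_mon_of_lt
      rcases Nat.eq_zero_or_pos k with rfl | hk0
      · rw [transfer_zero]
        exact rho_swap_lt hip (by omega)
      · exact rho_transfer_lt hip.ne hk0 hk

lemma div_sub_swap {F : Type*} [Field F] (a b c t : F) :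
    -(a / (c - b) * t) = a / (b - c) * t := by
  rw [← neg_sub b c, div_neg]; ring

lemma exists_tri_lower {i p : Fin N} (hip : p < i) (η : Fin N → ℕ) :
    ∃ R : MvPolynomial (Fin N) K, toRat R = toRat (X i) / (toRat (X i) - toRat (X p)) *
      toRat (mon K η - rename (Equiv.swap i p) (mon K η)) ∧
      Tri R η (if η p < η i then 1 else 0) := by
  rcases le_or_gt (η p) (η i) with h | h
  · exact exists_tri_big hip.ne' h
  · obtain ⟨R, h1, h2⟩ := exists_tri_small (K := K) hip h.le
    refine ⟨-R, ?_, ?_⟩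
    · simp only [toRat, map_neg] at h1 ⊢
      rw [h1, Equiv.swap_comm, div_sub_swap]
    · rw [if_neg (by omega)]
      simpa using h2.neg

lemma exists_tri_upper {i p : Fin N} (hip : i < p) (η : Fin N → ℕ) :
    ∃ R : MvPolynomial (Fin N) K, toRat R = toRat (X p) / (toRat (X i) - toRat (X p)) *
      toRat (mon K η - rename (Equiv.swap i p) (mon K η)) ∧
      Tri R η (-if η i < η p then 1 else 0) := by
  rcases le_or_gt (η p) (η i) with h | h
  · rw [if_neg (by omega), neg_zero]
    exact exists_tri_small hip h
  · obtain ⟨R, h1, h2⟩ := exists_tri_big (K := K) hip.ne' h.le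
    refine ⟨-R, ?_, h2.neg⟩
    simp only [toRat, map_neg] at h1 ⊢
    rw [h1, Equiv.swap_comm, div_sub_swap]

lemma exists_tri_xi (α : K) (i : Fin N) (η : Fin N → ℕ) :
    ∃ R : MvPolynomial (Fin N) K, toRat R = xi α i (mon K η) ∧ Tri R η (etaBar α η i) := by
  have hl : ∀ p : Fin N, ∃ R : MvPolynomial (Fin N) K, p < i →
      toRat R = toRat (X i) / (toRat (X i) - toRat (X p)) *
        toRat (mon K η - rename (Equiv.swap i p) (mon K η)) ∧
      Tri R η (if η p < η i then 1 else 0) := fun p => by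
    by_cases h : p < i
    · obtain ⟨R, hR⟩ := exists_tri_lower (K := K) h η
      exact ⟨R, fun _ => hR⟩
    · exact ⟨0, fun h' => absurd h' h⟩
  have hu : ∀ p : Fin N, ∃ R : MvPolynomial (Fin N) K, i < p →
      toRat R = toRat (X p) / (toRat (X i) - toRat (X p)) *
        toRat (mon K η - rename (Equiv.swap i p) (mon K η)) ∧
      Tri R η (-if η i < η p then 1 else 0) := fun p => by
    by_cases h : i < p
    · obtain ⟨R, hR⟩ := exists_tri_upper (K := K) h η
      exact ⟨R, fun _ => hR⟩
    · exact ⟨0, fun h' => absurd h' h⟩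
  choose L hL using hl
  choose U hU using hu
  refine ⟨C (α * η i) * mon K η + ∑ p ∈ Iio i, L p + ∑ p ∈ Ioi i, U p +
    -(C ((i : ℕ) : K) * mon K η), ?_, ?_⟩
  · rw [xi, ← Finset.sum_congr rfl fun p hp => (hL p (mem_Iio.1 hp)).1,
      ← Finset.sum_congr rfl fun p hp => (hU p (mem_Ioi.1 hp)).1, mul_assoc, X_mul_pderiv_mon]
    simp only [toRat, map_add, map_sum, map_neg, map_mul]
    ring
  · have h := (((tri_C_mul_mon (α * η i) η).add
      (Tri.sum (Iio i) fun p hp => (hL p (mem_Iio.1 hp)).2)).add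
      (Tri.sum (Ioi i) fun p hp => (hU p (mem_Ioi.1 hp)).2)).add
      (tri_C_mul_mon ((i : ℕ) : K) η).neg
    convert h using 1
    rw [etaBar, Finset.sum_neg_distrib, ← Finset.sum_filter, ← Finset.sum_filter,
      Finset.sum_const, Finset.sum_const, nsmul_one, nsmul_one]
    -- The constant `-i` counts all positions before `i`; those with a smaller entry cancel the
    -- diagonal terms of the lower sum, which leaves the first count in `η̄ᵢ`.
    have e1 : ((Iio i).filter fun p => η p < η i).card + #{k : Fin N | k < i ∧ η i ≤ η k} = i := by
      rw [← Finset.card_union_of_disjoint]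
      · conv_rhs => rw [← Fin.card_Iio i]
        congr 1
        ext k
        simp only [mem_union, mem_filter, mem_Iio, mem_univ, true_and]
        omega
      · rw [Finset.disjoint_left]
        intro k
        simp only [mem_filter, mem_univ, true_and]
        omega
    have e2 : (Ioi i).filter (fun p => η i < η p) = ({k : Fin N | i < k ∧ η i < η k} : Finset _) := by
      ext k
      simp
    rw [e2]
    have e3 : ((i : ℕ) : K) = ((Iio i).filter fun p => η p < η i).card +
        (#{k : Fin N | k < i ∧ η i ≤ η k} : K) := by
      rw [← Nat.cast_add, e1]
    rw [e3]
    ring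

lemma xi_add (α : K) (i : Fin N) (f g : MvPolynomial (Fin N) K) :
    xi α i (f + g) = xi α i f + xi α i g := by
  simp only [xi, toRat, map_add, mul_add, add_sub_add_comm, Finset.sum_add_distrib]
  ring

lemma xi_C_mul (α : K) (i : Fin N) (c : K) (f : MvPolynomial (Fin N) K) :
    xi α i (C c * f) = toRat (C c) * xi α i f := by
  have h : ∀ p, C c * f - rename (Equiv.swap i p) (C c * f) =
      C c * (f - rename (Equiv.swap i p) f) := fun p => by
    rw [map_mul, rename_C]; ring
  have hd : C α * X i * pderiv i (C c * f) = C c * (C α * X i * pderiv i f) := by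
    rw [pderiv_C_mul]; ring
  have hm : ∀ (t : FractionRing (MvPolynomial (Fin N) K)) (g : MvPolynomial (Fin N) K),
      t * toRat (C c * g) = toRat (C c) * (t * toRat g) := fun t g => by
    rw [toRat, map_mul, mul_left_comm]
  have h1 : ∀ g : MvPolynomial (Fin N) K, toRat (C c * g) = toRat (C c) * toRat g := fun g => by
    rw [toRat, map_mul]
  rw [xi, xi, hd, mul_left_comm (C ((i : ℕ) : K)), mul_sub, mul_add, mul_add, Finset.mul_sum,
    Finset.mul_sum, h1, h1]
  simp only [h, hm]

lemma xi_zero (α : K) (i : Fin N) : xi α i (0 : MvPolynomial (Fin N) K) = 0 := by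
  simpa using xi_C_mul α i 0 (0 : MvPolynomial (Fin N) K)

lemma xi_sub (α : K) (i : Fin N) (f g : MvPolynomial (Fin N) K) :
    xi α i (f - g) = xi α i f - xi α i g := by
  rw [eq_sub_iff_add_eq, ← xi_add, sub_add_cancel]

lemma xi_sum (α : K) (i : Fin N) {ι : Type*} (s : Finset ι) (f : ι → MvPolynomial (Fin N) K) :
    xi α i (∑ k ∈ s, f k) = ∑ k ∈ s, xi α i (f k) := by
  classical
  induction s using Finset.induction_on with
  | empty => simp [xi_zero]
  | insert a s ha ih => rw [Finset.sum_insert ha, Finset.sum_insert ha, xi_add, ih]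

/-- A simultaneous eigenfunction of the `ξᵢ`, with eigenvalues `eᵢ`. -/
def IsEigen (α : K) (e : Fin N → K) (f : MvPolynomial (Fin N) K) : Prop :=
  ∀ i, xi α i f = toRat (C (e i) * f)

lemma IsEigen.sub {α : K} {e : Fin N → K} {f g : MvPolynomial (Fin N) K} (h : IsEigen α e f)
    (h' : IsEigen α e g) : IsEigen α e (f - g) := by
  intro i
  rw [xi_sub, h i, h' i, toRat, toRat, toRat, ← map_sub]
  congr 1
  ring

/-- By triangularity no other monomial of `f` contributes to a `rho`-maximal `z^ν` in `ξᵢ f`, so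
comparing coefficients there yields the diagonal entry. -/
lemma IsEigen.eq_of_maximal {α : K} {e : Fin N → K} {f : MvPolynomial (Fin N) K}
    (h : IsEigen α e f) {ν : Fin N → ℕ} (hν : co ν f ≠ 0)
    (hmax : ∀ μ, co μ f ≠ 0 → rho μ ≤ rho ν) (i : Fin N) : e i = etaBar α ν i := by
  choose R hR hT using fun η => exists_tri_xi α i η
  have h1 : C (e i) * f = ∑ η ∈ compSupport f, C (co η f) * R η := by
    apply toRat_injective
    rw [← h i]
    conv_lhs => rw [eq_sum_mon f]
    rw [xi_sum, toRat, map_sum]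
    refine Finset.sum_congr rfl fun η _ => ?_
    rw [xi_C_mul, ← hR, toRat, toRat, map_mul]
  have h2 := congrArg (co ν) h1
  rw [co_C_mul, map_sum, Finset.sum_eq_single ν] at h2
  · rw [co_C_mul, hT ν ν le_rfl, if_pos rfl, mul_comm] at h2
    exact mul_left_cancel₀ hν h2
  · intro η hη hne
    rw [co_C_mul, hT η ν (hmax η (mem_compSupport.1 hη)), if_neg hne.symm, mul_zero]
  · intro h
    exact absurd (mem_compSupport.2 hν) h

lemma exists_maximal {f : MvPolynomial (Fin N) K} (hf : f ≠ 0) :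
    ∃ ν, co ν f ≠ 0 ∧ ∀ μ, co μ f ≠ 0 → rho μ ≤ rho ν := by
  obtain ⟨η, hη⟩ := exists_co_ne_zero hf
  obtain ⟨ν, h1, h2⟩ := Finset.exists_max_image (compSupport f) rho ⟨η, mem_compSupport.2 hη⟩
  exact ⟨ν, mem_compSupport.1 h1, fun μ hμ => h2 μ (mem_compSupport.2 hμ)⟩

variable [CharZero K] {α : K}

lemma IsEigen.eq_zero (hα : ∀ m n : ℕ, 0 < m → (m : K) * α + (n : K) ≠ 0)
    {η : Fin N → ℕ} {f : MvPolynomial (Fin N) K}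
    (h : IsEigen α (etaBar α η) f) (h0 : co η f = 0) : f = 0 := by
  by_contra hf
  obtain ⟨ν, hν, hmax⟩ := exists_maximal hf
  rw [eq_of_etaBar_eq hα (h.eq_of_maximal hν hmax)] at h0
  exact hν h0

/-- Distinct compositions may share a value of `rho`, but every monomial of maximal `rho` in `f` has
spectrum `η̄` and is therefore `z^η`. -/
lemma IsEigen.rho_lt (hα : ∀ m n : ℕ, 0 < m → (m : K) * α + (n : K) ≠ 0)
    {η : Fin N → ℕ} {f : MvPolynomial (Fin N) K}
    (h : IsEigen α (etaBar α η) f) {μ : Fin N → ℕ} (hμ : co μ f ≠ 0) (hne : μ ≠ η) :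
    rho μ < rho η := by
  have hf : f ≠ 0 := by rintro rfl; simp at hμ
  obtain ⟨ν, hν, hmax⟩ := exists_maximal hf
  obtain rfl := eq_of_etaBar_eq hα (h.eq_of_maximal hν hmax)
  refine lt_of_le_of_ne (hmax μ hμ) fun heq => hne ?_
  exact (eq_of_etaBar_eq hα (h.eq_of_maximal hμ (by rwa [heq]))).symm

end Triangularity

/-! ### Commutation of the operators with permutations and variables. -/

section Intertwining

variable {K : Type*} [Field K] {N : ℕ}

lemma toRat_mul (f g : MvPolynomial (Fin N) K) : toRat (f * g) = toRat f * toRat g := map_mul _ _ _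

lemma toRat_add (f g : MvPolynomial (Fin N) K) : toRat (f + g) = toRat f + toRat g := map_add _ _ _

lemma toRat_sub (f g : MvPolynomial (Fin N) K) : toRat (f - g) = toRat f - toRat g := map_sub _ _ _

/-- The permutation `w` of the variables acting on rational functions. -/
noncomputable def permRat (w : Equiv.Perm (Fin N)) :
    FractionRing (MvPolynomial (Fin N) K) →+* FractionRing (MvPolynomial (Fin N) K) :=
  IsFractionRing.map (A := MvPolynomial (Fin N) K) (B := MvPolynomial (Fin N) K)
    (j := (rename w : MvPolynomial (Fin N) K →ₐ[K] MvPolynomial (Fin N) K).toRingHom)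
    (rename_injective w w.injective)

lemma permRat_toRat (w : Equiv.Perm (Fin N)) (f : MvPolynomial (Fin N) K) :
    permRat w (toRat f) = toRat (rename w f) :=
  IsLocalization.map_eq (M := nonZeroDivisors (MvPolynomial (Fin N) K))
    (S := FractionRing (MvPolynomial (Fin N) K))
    (g := (rename w : MvPolynomial (Fin N) K →ₐ[K] MvPolynomial (Fin N) K).toRingHom)
    (nonZeroDivisors_le_comap_nonZeroDivisors_of_injective _ (rename_injective w w.injective)) f

/-- The divided difference `(f - s_{ip} f) / (zᵢ - z_p)`. -/
noncomputable def divDiff (i p : Fin N) (f : MvPolynomial (Fin N) K) :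
    FractionRing (MvPolynomial (Fin N) K) :=
  toRat (f - rename (Equiv.swap i p) f) / (toRat (X i) - toRat (X p))

lemma sub_mul_divDiff {i p : Fin N} (h : i ≠ p) (f : MvPolynomial (Fin N) K) :
    (toRat (X i) - toRat (X p)) * divDiff i p f = toRat f - toRat (rename (Equiv.swap i p) f) := by
  rw [divDiff, mul_div_cancel₀ _ (toRat_X_sub_ne_zero h), toRat_sub]

lemma permRat_divDiff (w : Equiv.Perm (Fin N)) (i p : Fin N) (f : MvPolynomial (Fin N) K) :
    permRat w (divDiff i p f) = divDiff (w i) (w p) (rename w f) := by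
  rw [divDiff, divDiff, map_div₀, map_sub, permRat_toRat, permRat_toRat, permRat_toRat, map_sub,
    rename_X, rename_X, rename_rename, rename_rename]
  have : ⇑w ∘ ⇑(Equiv.swap i p) = ⇑(Equiv.swap (w i) (w p)) ∘ ⇑w := by
    ext x
    simp [Equiv.swap_apply_def]
    split_ifs <;> simp_all
  rw [this]

lemma xi_eq (α : K) (i : Fin N) (f : MvPolynomial (Fin N) K) :
    xi α i f = toRat (C α * (X i * pderiv i f))
      + ∑ p ∈ univ.erase i, (if p < i then toRat (X i) else toRat (X p)) * divDiff i p f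
      - toRat (C ((i : ℕ) : K) * f) := by
  have h : (univ.erase i : Finset (Fin N)) = Iio i ∪ Ioi i := by
    ext p
    simp only [mem_erase, mem_univ, and_true, mem_union, mem_Iio, mem_Ioi, ne_iff_lt_or_gt]
  have hd : Disjoint (Iio i) (Ioi i) := by
    rw [Finset.disjoint_left]
    intro p
    simp only [mem_Iio, mem_Ioi]
    exact fun h1 h2 => lt_asymm h1 h2
  rw [xi, h, Finset.sum_union hd, ← add_assoc, mul_assoc]
  congr 2
  · congr 1
    refine Finset.sum_congr rfl fun p hp => ?_
    rw [if_pos (mem_Iio.1 hp), divDiff, div_mul_eq_mul_div, mul_div_assoc]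
  · refine Finset.sum_congr rfl fun p hp => ?_
    rw [if_neg (not_lt.2 (mem_Ioi.1 hp).le), divDiff, div_mul_eq_mul_div, mul_div_assoc]

lemma permRat_xi (α : K) (w : Equiv.Perm (Fin N)) (k : Fin N) (f : MvPolynomial (Fin N) K) :
    permRat w (xi α (w.symm k) f) = toRat (C α * (X k * pderiv k (rename w f)))
      + ∑ p ∈ univ.erase k, (if w.symm p < w.symm k then toRat (X k) else toRat (X p)) *
          divDiff k p (rename w f)
      - toRat (C ((w.symm k : ℕ) : K) * rename w f) := by
  rw [xi_eq, map_sub, map_add, permRat_toRat, permRat_toRat, map_sum, map_mul, map_mul, map_mul,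
    rename_C, rename_C, rename_X, Equiv.apply_symm_apply]
  have h1 : rename w (pderiv (w.symm k) f) = pderiv k (rename w f) := by
    rw [← pderiv_rename w.injective, Equiv.apply_symm_apply]
  rw [h1]
  congr 2
  refine Finset.sum_equiv w (by simp [Equiv.eq_symm_apply]) fun p _ => ?_
  rw [map_mul, permRat_divDiff, Equiv.apply_symm_apply, Equiv.symm_apply_apply]
  congr 1
  split_ifs <;> rw [permRat_toRat, rename_X]
  rw [Equiv.apply_symm_apply]

/-- Conjugation by `w` affects only the order relation that selects the numerator `z_k` or `z_p`,
and the constant; derivatives and divided differences are equivariant. -/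
lemma xi_rename_sub (α : K) (w : Equiv.Perm (Fin N)) (k : Fin N) (f : MvPolynomial (Fin N) K) :
    xi α k (rename w f) - permRat w (xi α (w.symm k) f) =
      ∑ p ∈ univ.erase k, ((if p < k then toRat (X k) else toRat (X p)) -
        if w.symm p < w.symm k then toRat (X k) else toRat (X p)) * divDiff k p (rename w f)
      - (toRat (C ((k : ℕ) : K) * rename w f) - toRat (C ((w.symm k : ℕ) : K) * rename w f)) := by
  rw [permRat_xi, xi_eq]
  simp only [sub_mul, Finset.sum_sub_distrib]
  abel

lemma swap_lt_swap_iff {i j : Fin N} (hij : (i : ℕ) + 1 = j) {p k : Fin N}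
    (h : ¬ (p = i ∧ k = j)) (h' : ¬ (p = j ∧ k = i)) :
    Equiv.swap i j p < Equiv.swap i j k ↔ p < k := by
  have e : ∀ a b : Fin N, a = b ↔ (a : ℕ) = b := fun a b => Fin.ext_iff
  have hs : ∀ q : Fin N, ((Equiv.swap i j q : Fin N) : ℕ) =
      if (q : ℕ) = i then (j : ℕ) else if (q : ℕ) = j then (i : ℕ) else q := fun q => by
    rw [Equiv.swap_apply_def]
    simp only [e]
    split_ifs <;> rfl
  rw [e, e] at h h'
  rw [Fin.lt_def, Fin.lt_def, hs, hs]
  split_ifs <;> omega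

/-- Only the comparison of `i` with `j` changes. In that term the numerators differ by `±(zᵢ -
z_j)`, which clears the denominator; the shift of the constant by one removes the permuted `f` and
leaves `f`. -/
lemma xi_swap_left (α : K) {i j : Fin N} (hij : (i : ℕ) + 1 = j) (f : MvPolynomial (Fin N) K) :
    xi α i (rename (Equiv.swap i j) f) =
      permRat (Equiv.swap i j) (xi α j f) + toRat f := by
  have hlt : i < j := by rw [Fin.lt_def]; omega
  have h := xi_rename_sub α (Equiv.swap i j) i f
  rw [Equiv.symm_swap, Equiv.swap_apply_left, Finset.sum_eq_single j] at h
  · rw [Equiv.swap_apply_right, if_neg (not_lt.2 hlt.le), if_pos hlt, ← neg_sub (toRat (X i)), neg_mul,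
      sub_mul_divDiff hlt.ne, rename_rename] at h
    have hf : rename (⇑(Equiv.swap i j) ∘ ⇑(Equiv.swap i j)) f = f := by
      rw [← Equiv.coe_trans]; simp
    rw [hf, ← hij, Nat.cast_succ, C_add, C_1, add_mul, one_mul, toRat_add] at h
    rw [← sub_eq_iff_eq_add', h]
    abel
  · intro p hp hpj
    rw [mem_erase] at hp
    have := swap_lt_swap_iff hij (p := p) (k := i) (by tauto) (by tauto)
    rw [Equiv.swap_apply_left] at this
    simp only [this, sub_self, zero_mul]
  · intro hj
    exact absurd (mem_erase.2 ⟨hlt.ne', mem_univ _⟩) hj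

lemma xi_swap_right (α : K) {i j : Fin N} (hij : (i : ℕ) + 1 = j) (f : MvPolynomial (Fin N) K) :
    xi α j (rename (Equiv.swap i j) f) =
      permRat (Equiv.swap i j) (xi α i f) - toRat f := by
  have hlt : i < j := by rw [Fin.lt_def]; omega
  have h := xi_rename_sub α (Equiv.swap i j) j f
  rw [Equiv.symm_swap, Equiv.swap_apply_right, Finset.sum_eq_single i] at h
  · rw [Equiv.swap_apply_left, if_neg (not_lt.2 hlt.le), if_pos hlt,
      sub_mul_divDiff hlt.ne', Equiv.swap_comm j i, rename_rename] at h
    have hf : rename (⇑(Equiv.swap i j) ∘ ⇑(Equiv.swap i j)) f = f := by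
      rw [← Equiv.coe_trans]; simp
    rw [hf, ← hij, Nat.cast_succ, C_add, C_1, add_mul, one_mul, toRat_add] at h
    rw [← sub_eq_zero, sub_sub_eq_add_sub, add_sub_right_comm, h]
    abel
  · intro p hp hpj
    rw [mem_erase] at hp
    have := swap_lt_swap_iff hij (p := p) (k := j) (by tauto) (by tauto)
    rw [Equiv.swap_apply_right] at this
    simp only [this, sub_self, zero_mul]
  · intro hj
    exact absurd (mem_erase.2 ⟨hlt.ne, mem_univ _⟩) hj

lemma xi_swap_of_ne (α : K) {i j : Fin N} (hij : (i : ℕ) + 1 = j) {k : Fin N} (hi : k ≠ i)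
    (hj : k ≠ j) (f : MvPolynomial (Fin N) K) :
    xi α k (rename (Equiv.swap i j) f) = permRat (Equiv.swap i j) (xi α k f) := by
  have h := xi_rename_sub α (Equiv.swap i j) k f
  rw [Equiv.symm_swap, Equiv.swap_apply_of_ne_of_ne hi hj, Finset.sum_eq_zero, sub_self, sub_zero,
    sub_eq_zero] at h
  · exact h
  · intro p hp
    have := swap_lt_swap_iff hij (p := p) (k := k) (by tauto) (by tauto)
    rw [Equiv.swap_apply_of_ne_of_ne hi hj] at this
    simp only [this, sub_self, zero_mul]

/-- The intertwiner `sᵢ - 1/δ` exchanges two adjacent eigenvalues. -/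
lemma IsEigen.swap {α : K} {e : Fin N → K} {f : MvPolynomial (Fin N) K} (h : IsEigen α e f)
    {i j : Fin N} (hij : (i : ℕ) + 1 = j) (hne : e i ≠ e j) :
    IsEigen α (e ∘ Equiv.swap i j)
      (rename (Equiv.swap i j) f - C (e i - e j)⁻¹ * f) := by
  intro k
  -- The extra `±f` produced by the transposition is absorbed because the coefficient of `f` is the
  -- inverse eigenvalue difference.
  have hd : (e i - e j) * (e i - e j)⁻¹ = 1 := mul_inv_cancel₀ (sub_ne_zero.2 hne)
  rw [xi_sub, xi_C_mul, h k, Function.comp]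
  rcases eq_or_ne k i with rfl | hki
  · rw [xi_swap_left α hij, h j, permRat_toRat, Equiv.swap_apply_left, ← toRat_add, ← toRat_mul,
      ← toRat_sub, map_mul, rename_C]
    congr 1
    rw [← mul_assoc, ← MvPolynomial.C_mul, mul_sub, ← mul_assoc,
      ← MvPolynomial.C_mul]
    have : (e k - e j)⁻¹ * e k = 1 + e j * (e k - e j)⁻¹ := by linear_combination hd
    rw [this, C_add, C_1]
    ring
  rcases eq_or_ne k j with rfl | hkj
  · rw [xi_swap_right α hij, h i, permRat_toRat, Equiv.swap_apply_right, ← toRat_mul,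
      ← toRat_sub, ← toRat_sub, map_mul, rename_C]
    congr 1
    rw [← mul_assoc, ← MvPolynomial.C_mul, mul_sub, ← mul_assoc,
      ← MvPolynomial.C_mul]
    have : e i * (e i - e k)⁻¹ = 1 + (e i - e k)⁻¹ * e k := by linear_combination hd
    rw [this, C_add, C_1]
    ring
  · rw [xi_swap_of_ne α hij hki hkj, h k, permRat_toRat, Equiv.swap_apply_of_ne_of_ne hki hkj,
      ← toRat_mul, ← toRat_sub, map_mul, rename_C]
    congr 1
    ring

lemma divDiff_X_mul_of_ne {a k p : Fin N} (hk : k ≠ a) (hp : p ≠ a) (g : MvPolynomial (Fin N) K) :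
    divDiff k p (X a * g) = toRat (X a) * divDiff k p g := by
  rw [divDiff, map_mul, rename_X, Equiv.swap_apply_of_ne_of_ne hk.symm hp.symm, ← mul_sub,
    toRat_mul, mul_div_assoc, divDiff]

lemma divDiff_X_mul_left {a p : Fin N} (hp : a ≠ p) (g : MvPolynomial (Fin N) K) :
    divDiff a p (X a * g) =
      toRat (X a) * divDiff a p g + toRat (rename (Equiv.swap a p) g) := by
  have h0 := toRat_X_sub_ne_zero (K := K) hp
  apply mul_left_cancel₀ h0
  rw [sub_mul_divDiff hp, mul_add, mul_left_comm, sub_mul_divDiff hp, map_mul, rename_X,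
    Equiv.swap_apply_left, toRat_mul, toRat_mul]
  ring

lemma divDiff_comm (i p : Fin N) (f : MvPolynomial (Fin N) K) :
    divDiff i p f = - divDiff p i f := by
  rw [divDiff, divDiff, Equiv.swap_comm, ← neg_sub (toRat (X p)), div_neg]

lemma X_mul_pderiv_X_mul_of_ne {a k : Fin N} (h : k ≠ a) (g : MvPolynomial (Fin N) K) :
    X k * pderiv k (X a * g) = X a * (X k * pderiv k g) := by
  rw [pderiv_mul, pderiv_X_of_ne h.symm]
  ring

lemma X_mul_pderiv_X_mul_self (a : Fin N) (g : MvPolynomial (Fin N) K) :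
    X a * pderiv a (X a * g) = X a * (X a * pderiv a g) + X a * g := by
  rw [pderiv_mul, pderiv_X_self]
  ring

end Intertwining

/-! ### The raising operator. -/

section Raising

variable {K : Type*} [Field K] {N : ℕ} [NeZero N]

/-- The raising operator `Φ f = z_N f(z_N, z₁, …, z_{N-1})`. -/
noncomputable def raise : MvPolynomial (Fin N) K →ₗ[K] MvPolynomial (Fin N) K :=
  LinearMap.mulLeft K (X top) ∘ₗ (rename (rot : Equiv.Perm (Fin N)).symm).toLinearMap

lemma raise_apply (f : MvPolynomial (Fin N) K) : raise f = X top * rename rot.symm f := rfl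

lemma co_raise (f : MvPolynomial (Fin N) K) (η : Fin N → ℕ) : co (phi η) (raise f) = co η f := by
  have h1 : co η f = co (η ∘ rot) (rename rot.symm f) := by
    rw [co_rename]
    refine congrArg (fun ν => co ν f) (funext fun i => ?_)
    simp
  rw [h1, raise_apply]
  simp only [co, lcoeff, LinearMap.coe_mk, AddHom.coe_mk]
  rw [← coeff_X_mul (Finsupp.equivFunOnFinite.symm (η ∘ rot)) top (rename rot.symm f)]
  congr 1
  ext i
  simp only [Finsupp.equivFunOnFinite_symm_apply_apply, phi, Finsupp.add_apply, Function.comp,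
    Finsupp.single_apply, rot_eq_zero_iff, eq_comm (a := top)]
  exact add_comm _ _

lemma rot_lt_rot_iff {k p : Fin N} (hk : k ≠ top) (hp : p ≠ top) :
    rot p < rot k ↔ p < k := by
  have h1 : (k : ℕ) ≠ (top : Fin N) := fun h => hk (Fin.ext h)
  have h2 : (p : ℕ) ≠ (top : Fin N) := fun h => hp (Fin.ext h)
  have h3 := coe_top (N := N)
  have h4 := coe_rot k
  have h5 := coe_rot p
  rw [if_neg (by omega)] at h4 h5
  rw [Fin.lt_def, Fin.lt_def, h4, h5]
  omega

lemma zero_lt_rot {k : Fin N} (hk : k ≠ top) : 0 < rot k := by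
  rw [Fin.pos_iff_ne_zero]
  rwa [Ne, rot_eq_zero_iff]

lemma lt_top' {k : Fin N} (hk : k ≠ top) : k < top := by
  have h1 : (k : ℕ) ≠ (top : Fin N) := fun h => hk (Fin.ext h)
  have h3 := coe_top (N := N)
  have := k.isLt
  rw [Fin.lt_def]
  omega

/-- Rotation changes the order only in comparisons with `top`. In that term the changed numerator,
the remainder of the product rule and the shift of the constant by one cancel. -/
lemma xi_raise_of_ne (α : K) {k : Fin N} (hk : k ≠ top) (f : MvPolynomial (Fin N) K) :
    xi α k (raise f) = toRat (X top) * permRat rot.symm (xi α (rot k) f) := by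
  have h := permRat_xi α rot.symm k f
  rw [Equiv.symm_symm] at h
  rw [h, xi_eq, raise_apply]
  generalize rename rot.symm f = g
  have hmem : top ∈ univ.erase k := mem_erase.2 ⟨hk.symm, mem_univ _⟩
  rw [X_mul_pderiv_X_mul_of_ne hk, ← Finset.add_sum_erase _ _ hmem,
    ← Finset.add_sum_erase _ (fun p => (if rot p < rot k then toRat (X k) else toRat (X p)) *
      divDiff k p g) hmem,
    if_neg (not_lt.2 (lt_top' hk).le), if_pos (by rw [rot_top]; exact zero_lt_rot hk)]
  have hs : ∑ p ∈ (univ.erase k).erase top, (if p < k then toRat (X k) else toRat (X p)) *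
      divDiff k p (X top * g) = toRat (X top) *
      ∑ p ∈ (univ.erase k).erase top, (if rot p < rot k then toRat (X k) else toRat (X p)) *
      divDiff k p g := by
    rw [Finset.mul_sum]
    refine Finset.sum_congr rfl fun p hp => ?_
    rw [mem_erase] at hp
    rw [divDiff_X_mul_of_ne hk hp.1]
    simp only [rot_lt_rot_iff hk hp.1]
    exact mul_left_comm _ _ _
  have hr := coe_rot k
  rw [if_neg (fun h => hk (Fin.ext (by have := coe_top (N := N); omega)))] at hr
  rw [hs, hr, divDiff_comm, divDiff_X_mul_left hk.symm, Nat.cast_succ, C_add, C_1, divDiff_comm k]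
  have h1 := sub_mul_divDiff hk.symm g
  simp only [toRat_mul, toRat_add, add_mul, one_mul] at h1 ⊢
  linear_combination (- toRat (X top)) * h1

/-- The derivative of the extra factor contributes `α`. Each of the `N - 1` divided differences
contributes one copy of the raised polynomial, and together they cancel the constant of `ξ_N`. -/
lemma xi_raise_top (α : K) (f : MvPolynomial (Fin N) K) :
    xi α top (raise f) =
      toRat (X top) * permRat rot.symm (xi α 0 f) + toRat (C α * raise f) := by
  have h := permRat_xi α rot.symm top f
  rw [Equiv.symm_symm, rot_top] at h
  rw [h, xi_eq, raise_apply]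
  generalize rename rot.symm f = g
  have hs : ∑ p ∈ univ.erase top, (if p < top then toRat (X top) else toRat (X p)) *
      divDiff top p (X top * g) = toRat (X top) *
      ∑ p ∈ univ.erase top, (if rot p < 0 then toRat (X top) else toRat (X p)) *
      divDiff top p g + ∑ p ∈ univ.erase (top : Fin N), toRat (X top * g) := by
    rw [Finset.mul_sum, ← Finset.sum_add_distrib]
    refine Finset.sum_congr rfl fun p hp => ?_
    rw [mem_erase] at hp
    rw [if_pos (lt_top' hp.1), if_neg (by simp), divDiff_X_mul_left hp.1.symm]
    have h1 := sub_mul_divDiff hp.1.symm g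
    rw [toRat_mul]
    linear_combination (toRat (X top)) * h1
  have hc : ∑ p ∈ univ.erase (top : Fin N), toRat (X top * g) =
      toRat (C (((top : Fin N) : ℕ) : K) * (X top * g)) := by
    rw [Finset.sum_const, Finset.card_erase_of_mem (mem_univ _), Finset.card_univ,
      Fintype.card_fin]
    have := coe_top (N := N)
    rw [show N - 1 = ((top : Fin N) : ℕ) by omega]
    simp [toRat_mul, nsmul_eq_mul]
  rw [hs, hc, X_mul_pderiv_X_mul_self, coe_zero']
  simp only [toRat_mul, toRat_add, Nat.cast_zero, C_0, zero_mul, mul_add]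
  simp only [toRat, map_zero]
  ring

lemma IsEigen.raise {α : K} {e : Fin N → K} {f : MvPolynomial (Fin N) K} (h : IsEigen α e f) :
    IsEigen α (fun i => e (rot i) + if rot i = 0 then α else 0) (raise f) := by
  intro k
  rcases eq_or_ne k top with rfl | hk
  · simp only [rot_top, if_true]
    rw [xi_raise_top, h 0, permRat_toRat, ← toRat_mul, ← toRat_add, map_mul, rename_C, C_add, raise_apply]
    congr 1
    ring
  · simp only [rot_eq_zero_iff, hk, if_false]
    rw [xi_raise_of_ne α hk, h, permRat_toRat, ← toRat_mul, map_mul, rename_C, add_zero, raise_apply]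
    congr 1
    ring

end Raising

/-! ### Existence, uniqueness and basic actions on the Jack polynomials. -/

section Jack

variable {K : Type*} [Field K] {N : ℕ}

lemma isNonsymJack_iff {α : K} {η : Fin N → ℕ} {E : MvPolynomial (Fin N) K} :
    IsNonsymJack α η E ↔ IsEigen α (etaBar α η) E ∧ co η E = 1 := Iff.rfl

lemma IsNonsymJack.isEigen {α : K} {η : Fin N → ℕ} {E : MvPolynomial (Fin N) K}
    (h : IsNonsymJack α η E) : IsEigen α (etaBar α η) E := h.1

lemma IsNonsymJack.co_self {α : K} {η : Fin N → ℕ} {E : MvPolynomial (Fin N) K}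
    (h : IsNonsymJack α η E) : co η E = 1 := h.2

lemma etaBar_comp_swap (α : K) {η : Fin N → ℕ} {i j : Fin N} (hij : (i : ℕ) + 1 = j)
    (h : η i ≠ η j) : etaBar α η ∘ Equiv.swap i j = etaBar α (η ∘ Equiv.swap i j) :=
  funext fun k => (etaBar_swap α hij h k).symm

lemma comp_swap_swap {β : Type*} (η : Fin N → β) (i j : Fin N) :
    (η ∘ Equiv.swap i j) ∘ Equiv.swap i j = η := by
  ext k; simp

lemma rename_swap_rename_swap (i j : Fin N) (f : MvPolynomial (Fin N) K) :
    rename (Equiv.swap i j) (rename (Equiv.swap i j) f) = f := by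
  rw [rename_rename, ← Equiv.coe_trans]
  simp

lemma isNonsymJack_zero (α : K) : IsNonsymJack α (0 : Fin N → ℕ) 1 := by
  refine isNonsymJack_iff.2 ⟨fun i => ?_, ?_⟩
  · have h1 : etaBar α (0 : Fin N → ℕ) i = -((i : ℕ) : K) := by
      simp [etaBar, Finset.filter_gt_eq_Iio]
    rw [h1, xi]
    simp only [toRat, Derivation.map_one_eq_zero, mul_zero, map_zero, map_one, sub_self,
      Finset.sum_const_zero, add_zero, mul_one, zero_sub, map_neg]
  · have : co (0 : Fin N → ℕ) (mon K 0) = 1 := by rw [co_mon, if_pos rfl]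
    convert this
    rw [mon, ← C_1, C_apply]
    exact congrArg (fun d => monomial d (1 : K)) (Finsupp.ext fun _ => rfl)

lemma IsNonsymJack.raise [NeZero N] {α : K} {η : Fin N → ℕ} {E : MvPolynomial (Fin N) K}
    (h : IsNonsymJack α η E) : IsNonsymJack α (phi η) (raise E) := by
  refine isNonsymJack_iff.2 ⟨?_, ?_⟩
  · have h1 := h.isEigen.raise
    have h2 : (fun i => etaBar α η (rot i) + if rot i = 0 then α else 0) = etaBar α (phi η) :=
      funext fun i => (etaBar_phi α η i).symm
    rwa [h2] at h1
  · rw [co_raise, h.co_self]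

variable [CharZero K] {α : K}

/-- When `η i < η j` the exchanged monomial has larger `rho` and does not occur in `E_η`, so the
intertwiner preserves leading coefficient one. -/
lemma IsNonsymJack.swap (hα : ∀ m n : ℕ, 0 < m → (m : K) * α + (n : K) ≠ 0) {η : Fin N → ℕ}
    {E : MvPolynomial (Fin N) K} (h : IsNonsymJack α η E) {i j : Fin N}
    (hij : (i : ℕ) + 1 = j) (hlt : η i < η j) :
    IsNonsymJack α (η ∘ Equiv.swap i j)
      (rename (Equiv.swap i j) E - C (etaBar α η i - etaBar α η j)⁻¹ * E) := by
  have hne : i ≠ j := by rintro rfl; omega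
  have hlt' : i < j := by rw [Fin.lt_def]; omega
  refine isNonsymJack_iff.2 ⟨?_, ?_⟩
  · rw [← etaBar_comp_swap α hij hlt.ne]
    exact h.isEigen.swap hij ((etaBar_injective hα η).ne hne)
  · have h0 : co (η ∘ Equiv.swap i j) E = 0 := by
      by_contra hc
      have h1 := h.isEigen.rho_lt hα hc (fun he => by
        have := congrFun he i
        simp only [Function.comp, Equiv.swap_apply_left] at this
        omega)
      have h2 := rho_swap_lt (η := η ∘ Equiv.swap i j) hlt' (by simpa using hlt)
      rw [comp_swap_swap] at h2
      exact lt_asymm h1 h2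
    rw [map_sub, co_C_mul, h0, mul_zero, sub_zero, co_rename, comp_swap_swap, h.co_self]

/-- Induction on the degree, then on `rho`. A composition with positive last entry is `Φ` of one of
lower degree; any other nonzero one has an adjacent descent, and exchanging it lowers `rho`. -/
lemma exists_isNonsymJack [NeZero N] (hα : ∀ m n : ℕ, 0 < m → (m : K) * α + (n : K) ≠ 0)
    (η : Fin N → ℕ) : ∃ E : MvPolynomial (Fin N) K, IsNonsymJack α η E := by
  obtain ⟨n, hn⟩ : ∃ n, n = ∑ i, η i := ⟨_, rfl⟩
  induction n generalizing η with
  | zero =>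
    have : η = 0 := funext fun i => (Finset.sum_eq_zero_iff.1 hn.symm) i (mem_univ i)
    rw [this]
    exact ⟨1, isNonsymJack_zero α⟩
  | succ n ih =>
    induction η using (InvImage.wf rho (wellFounded_lt (α := ℕ ×ₗ ℕ))).induction with
    | _ η ih' =>
      rcases Nat.eq_zero_or_pos (η top) with h0 | hpos
      · obtain ⟨i, j, hij, hlt⟩ : ∃ i j : Fin N, (i : ℕ) + 1 = j ∧ η j < η i := by
          -- Without a descent the entries increase weakly up to the last one, which is zero, so the
          -- degree would vanish.
          by_contra! hc
          have hz : ∀ k : ℕ, ∀ i : Fin N, (i : ℕ) + k + 1 = N → η i = 0 := by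
            intro k
            induction k with
            | zero =>
              intro i hi
              have : i = top := Fin.ext (by have := coe_top (N := N); omega)
              rw [this, h0]
            | succ k ihk =>
              intro i hi
              have h1 := hc i ⟨i + 1, by omega⟩ rfl
              have h2 := ihk ⟨i + 1, by omega⟩ (by simp; omega)
              omega
          have : ∑ i, η i = 0 := Finset.sum_eq_zero fun i _ => hz (N - 1 - i) i (by omega)
          omega
        have hlt' : i < j := by rw [Fin.lt_def]; omega
        obtain ⟨E, hE⟩ := ih' (η ∘ Equiv.swap i j) (rho_swap_lt hlt' hlt)
          (by rw [hn]; exact (Equiv.sum_comp (Equiv.swap i j) η).symm)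
        have h2 := hE.swap hα hij (by simpa using hlt)
        rw [comp_swap_swap] at h2
        exact ⟨_, h2⟩
      · have hphi : phi (fun i => η (rot.symm i) - if i = 0 then 1 else 0) = η := by
          ext i
          simp only [phi, Equiv.symm_apply_apply]
          split_ifs with h
          · rw [rot_eq_zero_iff] at h
            subst h
            omega
          · omega
        obtain ⟨E, hE⟩ := ih (fun i => η (rot.symm i) - if i = 0 then 1 else 0) (by
          have h1 : ∑ i, η (rot.symm i) = n + 1 := by
            rw [hn]; exact Equiv.sum_comp rot.symm η
          have h2 : ∑ i : Fin N, ((η (rot.symm i) - if i = 0 then 1 else 0) +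
              if i = 0 then 1 else 0) = ∑ i, η (rot.symm i) := by
            refine Finset.sum_congr rfl fun i _ => ?_
            split_ifs with h
            · subst h
              change 0 < η (rot.symm 0) at hpos
              omega
            · omega
          rw [Finset.sum_add_distrib, h1] at h2
          simp only [Finset.sum_ite_eq', mem_univ, if_true] at h2
          omega)
        have := hE.raise
        rw [hphi] at this
        exact ⟨_, this⟩

lemma IsNonsymJack.unique (hα : ∀ m n : ℕ, 0 < m → (m : K) * α + (n : K) ≠ 0) {η : Fin N → ℕ}
    {E F : MvPolynomial (Fin N) K} (h : IsNonsymJack α η E) (h' : IsNonsymJack α η F) : E = F := by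
  rw [← sub_eq_zero]
  refine (h.isEigen.sub h'.isEigen).eq_zero hα ?_
  rw [map_sub, h.co_self, h'.co_self, sub_self]

lemma existsUnique_isNonsymJack [NeZero N]
    (hα : ∀ m n : ℕ, 0 < m → (m : K) * α + (n : K) ≠ 0) (η : Fin N → ℕ) :
    ∃! E : MvPolynomial (Fin N) K, IsNonsymJack α η E := by
  obtain ⟨E, hE⟩ := exists_isNonsymJack hα η
  exact ⟨E, hE, fun F hF => hF.unique hα hE⟩

variable [NeZero N]

lemma isNonsymJack_jackE (hα : ∀ m n : ℕ, 0 < m → (m : K) * α + (n : K) ≠ 0) (η : Fin N → ℕ) :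
    IsNonsymJack α η (jackE α η) :=
  Classical.epsilon_spec (exists_isNonsymJack hα η)

lemma raise_jackE (hα : ∀ m n : ℕ, 0 < m → (m : K) * α + (n : K) ≠ 0) (η : Fin N → ℕ) :
    raise (jackE α η) = jackE α (phi η) :=
  (isNonsymJack_jackE hα η).raise.unique hα (isNonsymJack_jackE hα _)

lemma swap_jackE_of_lt (hα : ∀ m n : ℕ, 0 < m → (m : K) * α + (n : K) ≠ 0) {η : Fin N → ℕ}
    {i j : Fin N} (hij : (i : ℕ) + 1 = j) (hlt : η i < η j) :
    rename (Equiv.swap i j) (jackE α η) = C (etaBar α η i - etaBar α η j)⁻¹ * jackE α η +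
      jackE α (η ∘ Equiv.swap i j) := by
  rw [← ((isNonsymJack_jackE hα η).swap hα hij hlt).unique hα (isNonsymJack_jackE hα _)]
  ring

/-- Obtained from the ascending case for the exchanged composition by applying the involution once
more and solving for the image of `E_η`. -/
lemma swap_jackE_of_gt (hα : ∀ m n : ℕ, 0 < m → (m : K) * α + (n : K) ≠ 0) {η : Fin N → ℕ}
    {i j : Fin N} (hij : (i : ℕ) + 1 = j) (hlt : η j < η i) :
    rename (Equiv.swap i j) (jackE α η) = C (etaBar α η i - etaBar α η j)⁻¹ * jackE α η +
      C (1 - (etaBar α η i - etaBar α η j)⁻¹ ^ 2) * jackE α (η ∘ Equiv.swap i j) := by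
  have h := swap_jackE_of_lt hα (η := η ∘ Equiv.swap i j) hij (by simpa using hlt)
  have h2 := congrArg (rename (Equiv.swap i j)) h
  rw [etaBar_swap α hij hlt.ne', etaBar_swap α hij hlt.ne', comp_swap_swap, Equiv.swap_apply_left,
    Equiv.swap_apply_right, ← neg_sub (etaBar α η i), inv_neg] at h
  rw [etaBar_swap α hij hlt.ne', etaBar_swap α hij hlt.ne', comp_swap_swap, Equiv.swap_apply_left,
    Equiv.swap_apply_right, ← neg_sub (etaBar α η i), inv_neg, map_add, map_mul, rename_C,
    rename_swap_rename_swap] at h2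
  simp only [C_sub, C_pow, C_neg, C_1] at *
  linear_combination (- 1) * h2 + C (etaBar α η i - etaBar α η j)⁻¹ * h

/-- The intertwiner yields an eigenfunction whose spectrum is `η̄` with entries `i, j` exchanged. No
composition `ν` has this spectrum: `ν i = ν j` would give difference `+1` instead of `-1`, and `ν i
≠ ν j` would make `η` the exchange of `ν`. So it vanishes. -/
lemma swap_jackE_of_eq (hα : ∀ m n : ℕ, 0 < m → (m : K) * α + (n : K) ≠ 0) {η : Fin N → ℕ}
    {i j : Fin N} (hij : (i : ℕ) + 1 = j) (heq : η i = η j) :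
    rename (Equiv.swap i j) (jackE α η) = jackE α η := by
  have hδ := etaBar_of_eq α hij heq
  have hE := (isNonsymJack_jackE hα η).isEigen.swap hij (by rw [hδ]; simp)
  rw [hδ, add_sub_cancel_left, inv_one, C_1, one_mul] at hE
  by_contra hne
  obtain ⟨ν, hν, hmax⟩ := exists_maximal (sub_ne_zero.2 hne)
  have hb := hE.eq_of_maximal hν hmax
  have hbi := hb i
  have hbj := hb j
  simp only [Function.comp, Equiv.swap_apply_left, Equiv.swap_apply_right] at hbi hbj
  rcases eq_or_ne (ν i) (ν j) with h | h
  · have := etaBar_of_eq α hij h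
    have h2 : (2 : K) = 0 := by linear_combination hbj - hbi - hδ - this
    exact two_ne_zero h2
  · have h1 : η = ν ∘ Equiv.swap i j := eq_of_etaBar_eq hα fun k => by
      rw [etaBar_swap α hij h, ← hb]
      simp
    rw [h1] at heq
    simp only [Function.comp, Equiv.swap_apply_left, Equiv.swap_apply_right] at heq
    exact h heq.symm

/-- At a `rho`-maximal index `ν` of the combination, the monomial `z^ν` occurs in `E_ν` alone. -/
lemma sum_jackE_eq_zero (hα : ∀ m n : ℕ, 0 < m → (m : K) * α + (n : K) ≠ 0)
    (c : (Fin N → ℕ) →₀ K) (h : c.sum (fun ν r => r • jackE α ν) = 0) : c = 0 := by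
  by_contra hc
  obtain ⟨ν, hν, hmax⟩ := Finset.exists_max_image c.support rho (Finsupp.support_nonempty_iff.2 hc)
  have h1 := congrArg (co ν) h
  rw [Finsupp.sum, map_sum, Finset.sum_eq_single ν, map_smul,
    (isNonsymJack_jackE hα ν).co_self, smul_eq_mul, mul_one, map_zero] at h1
  · exact Finsupp.mem_support_iff.1 hν h1
  · intro μ hμ hne
    rw [map_smul]
    by_contra h0
    have := (isNonsymJack_jackE hα μ).isEigen.rho_lt hα (μ := ν) (fun h => h0 (by simp [h]))
      hne.symm
    exact absurd this (not_lt.2 (hmax μ hμ))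
  · exact fun h => absurd hν h

end Jack

/-! ### Leg lengths under exchange and shift. -/

section Legs

variable {N : ℕ}

/-- The position `m` contributes to the leg length `l(k, c)`. -/
def InLeg (η : Fin N → ℕ) (k : Fin N) (c : ℕ) (m : Fin N) : Prop :=
  (m < k ∧ c ≤ η m + 1 ∧ η m + 1 ≤ η k) ∨ (k < m ∧ c ≤ η m ∧ η m ≤ η k)

instance (η : Fin N → ℕ) (k : Fin N) (c : ℕ) (m : Fin N) : Decidable (InLeg η k c m) := by
  unfold InLeg; infer_instance

lemma leg_eq (η : Fin N → ℕ) (k : Fin N) (c : ℕ) : leg η k c = #{m | InLeg η k c m} := by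
  unfold leg InLeg
  rw [← Finset.card_union_of_disjoint, ← Finset.filter_or]
  rw [Finset.disjoint_left]
  intro m
  simp only [mem_filter, mem_univ, true_and]
  omega

lemma leg_eq_of_equiv {η ν : Fin N → ℕ} {k l : Fin N} {c d : ℕ} (e : Equiv.Perm (Fin N))
    (h : ∀ m, InLeg ν k c m ↔ InLeg η l d (e m)) : leg ν k c = leg η l d := by
  rw [leg_eq, leg_eq]
  exact Finset.card_equiv e (by simp [h])

lemma inLeg_swap {η : Fin N → ℕ} {i j : Fin N} (hij : (i : ℕ) + 1 = j) {k m : Fin N} (c : ℕ)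
    (h : ¬ (m = i ∧ k = j)) (h' : ¬ (m = j ∧ k = i)) :
    InLeg (η ∘ Equiv.swap i j) k c m ↔ InLeg η (Equiv.swap i j k) c (Equiv.swap i j m) := by
  unfold InLeg
  rw [swap_lt_swap_iff hij h h', swap_lt_swap_iff hij (by tauto) (by tauto)]
  rfl

lemma leg_swap {η : Fin N → ℕ} {i j : Fin N} (hij : (i : ℕ) + 1 = j) (hlt : η i < η j)
    {k : Fin N} (hk : k ≠ i) (c : ℕ) :
    leg (η ∘ Equiv.swap i j) k c = leg η (Equiv.swap i j k) c := by
  refine leg_eq_of_equiv (Equiv.swap i j) fun m => ?_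
  by_cases h : m = i ∧ k = j
  · obtain ⟨rfl, rfl⟩ := h
    simp only [InLeg, Function.comp, Equiv.swap_apply_left, Equiv.swap_apply_right]
    omega
  · exact inLeg_swap hij c h (by tauto)

/-- The shorter row counts up to column `η i + 1` when it lies to the left of the longer one, and
only up to `η i` when it lies to the right. -/
lemma leg_swap_left {η : Fin N → ℕ} {i j : Fin N} (hij : (i : ℕ) + 1 = j) (hlt : η i < η j)
    (c : ℕ) : leg η j c = leg (η ∘ Equiv.swap i j) i c + if c = η i + 1 then 1 else 0 := by
  have hne : i < j := by rw [Fin.lt_def]; omega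
  have key : ∀ m, m ≠ j →
      (InLeg (η ∘ Equiv.swap i j) i c m ↔ InLeg η j c (Equiv.swap i j m)) := fun m hm => by
    rw [inLeg_swap hij c (by simp [hne.ne]) (by tauto), Equiv.swap_apply_left]
  have hj : InLeg (η ∘ Equiv.swap i j) i c j ↔ c ≤ η i := by
    simp only [InLeg, Function.comp, Equiv.swap_apply_left, Equiv.swap_apply_right]
    omega
  have hj' : InLeg η j c i ↔ c ≤ η i + 1 := by
    simp only [InLeg]
    omega
  have e1 : leg η j c = #{m | InLeg η j c (Equiv.swap i j m)} := by
    rw [leg_eq]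
    exact (Finset.card_equiv (Equiv.swap i j) (by simp)).symm
  rw [e1, leg_eq]
  split_ifs with h
  · rw [← Finset.card_insert_of_notMem (a := j)
      (by rw [mem_filter, hj]; omega)]
    congr 1
    ext m
    simp only [mem_filter, mem_univ, true_and, mem_insert]
    by_cases hm : m = j
    · subst hm
      simp only [Equiv.swap_apply_right, hj', true_or, iff_true]
      omega
    · simp only [hm, false_or, key m hm]
  · rw [add_zero]
    congr 1
    ext m
    simp only [mem_filter, mem_univ, true_and]
    by_cases hm : m = j
    · subst hm
      rw [Equiv.swap_apply_right, hj', hj]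
      omega
    · rw [key m hm]

/-- After exchanging `i` and `j`, the positions preceding `i` are those preceding `j` together with
the leg of `j` in column `η i + 1`. Hence the factor of `d'_η` at this node is an eigenvalue
difference. -/
lemma leg_add_rk {η : Fin N → ℕ} {i j : Fin N} (hij : (i : ℕ) + 1 = j) (hlt : η i < η j) :
    leg η j (η i + 1) + rk η j = rk η i := by
  have hne : i ≠ j := by rintro rfl; omega
  unfold rk
  rw [leg_eq, ← Finset.card_union_of_disjoint, ← Finset.filter_or]
  · refine Finset.card_equiv (Equiv.swap i j) fun m => ?_
    simp only [mem_filter, mem_univ, true_and]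
    by_cases hi : m = i
    · subst hi
      simp only [InLeg, Above, Equiv.swap_apply_left]
      omega
    by_cases hj : m = j
    · subst hj
      simp only [InLeg, Above, Equiv.swap_apply_right]
      omega
    rw [Equiv.swap_apply_of_ne_of_ne hi hj]
    have : (m : ℕ) ≠ i := fun h => hi (Fin.ext h)
    have : (m : ℕ) ≠ j := fun h => hj (Fin.ext h)
    unfold InLeg Above
    omega
  · rw [Finset.disjoint_left]
    intro m
    simp only [mem_filter, mem_univ, true_and]
    unfold InLeg Above
    omega

variable [NeZero N]

lemma leg_phi_of_ne (η : Fin N → ℕ) {k : Fin N} (hk : k ≠ top) (c : ℕ) :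
    leg (phi η) k c = leg η (rot k) c := by
  refine leg_eq_of_equiv rot fun m => ?_
  unfold InLeg phi
  simp only [rot_eq_zero_iff, hk, if_false, add_zero]
  by_cases hm : m = top
  · subst hm
    have h1 := lt_top' hk
    have h2 := zero_lt_rot hk
    rw [rot_top, if_pos rfl]
    omega
  · rw [rot_lt_rot_iff hk hm, rot_lt_rot_iff hm hk, if_neg hm, add_zero]

lemma leg_phi_top (η : Fin N → ℕ) (c : ℕ) : leg (phi η) top (c + 1) = leg η 0 c := by
  refine leg_eq_of_equiv rot fun m => ?_
  unfold InLeg phi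
  by_cases hm : m = top
  · subst hm
    simp [rot_top]
  · have h1 := lt_top' hm
    have h2 := zero_lt_rot hm
    simp only [rot_eq_zero_iff, hm, if_false, rot_top, if_true]
    omega

lemma leg_zero_add_rk (η : Fin N → ℕ) : leg η 0 0 + rk η 0 + 1 = N := by
  unfold rk
  rw [leg_eq, ← Finset.card_union_of_disjoint, ← Finset.filter_or]
  · rw [← Finset.card_insert_of_notMem (a := 0)]
    · conv_rhs => rw [← Fintype.card_fin N, ← Finset.card_univ]
      congr 1
      ext m
      simp only [mem_filter, mem_univ, true_and, mem_insert, iff_true]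
      by_cases hm : m = 0
      · exact Or.inl hm
      · right
        have : 0 < m := Fin.pos_iff_ne_zero.2 hm
        unfold InLeg Above
        omega
    · simp only [mem_filter, mem_univ, true_and]
      unfold InLeg Above
      omega
  · rw [Finset.disjoint_left]
    intro m
    simp only [mem_filter, mem_univ, true_and]
    have : ¬ m < 0 := by simp
    unfold InLeg Above
    omega

end Legs

/-! ### The constants and the normalized polynomials. -/

section Norms

variable {K : Type*} [Field K] {N : ℕ}

/-- The factor of `d'_η` that comes from the `k`th row. -/
noncomputable def dRow (α : K) (η : Fin N → ℕ) (k : Fin N) : K :=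
  ∏ c ∈ Icc 1 (η k), (α * (((η k : K) - (c : K)) + 1) + (leg η k c : K))

lemma dPrime_eq (α : K) (η : Fin N → ℕ) : dPrime α η = ∏ k, dRow α η k := rfl

lemma dRow_ne_zero [CharZero K] {α : K}
    (hα : ∀ m n : ℕ, 0 < m → (m : K) * α + (n : K) ≠ 0) (η : Fin N → ℕ) (k : Fin N) :
    dRow α η k ≠ 0 := by
  refine Finset.prod_ne_zero_iff.2 fun c hc => ?_
  rw [mem_Icc] at hc
  have := hα (η k - c + 1) (leg η k c) (by omega)
  rw [Nat.cast_succ, Nat.cast_sub hc.2] at this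
  rwa [mul_comm α]

lemma dPrime_ne_zero [CharZero K] {α : K}
    (hα : ∀ m n : ℕ, 0 < m → (m : K) * α + (n : K) ≠ 0) (η : Fin N → ℕ) : dPrime α η ≠ 0 :=
  Finset.prod_ne_zero_iff.2 fun k _ => dRow_ne_zero hα η k

lemma dRow_swap (α : K) {η : Fin N → ℕ} {i j : Fin N} (hij : (i : ℕ) + 1 = j)
    (hlt : η i < η j) {k : Fin N} (hk : k ≠ i) :
    dRow α (η ∘ Equiv.swap i j) k = dRow α η (Equiv.swap i j k) := by
  simp only [dRow, leg_swap hij hlt hk]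
  rfl

/-- Only the factor in column `η i + 1` changes. With `δ = η̄ᵢ - η̄ⱼ` it passes from `-δ` to `-δ -
1`. -/
lemma dRow_swap_left (α : K) {η : Fin N → ℕ} {i j : Fin N} (hij : (i : ℕ) + 1 = j)
    (hlt : η i < η j) (hne : etaBar α η i ≠ etaBar α η j) :
    dRow α (η ∘ Equiv.swap i j) i = (1 + (etaBar α η i - etaBar α η j)⁻¹) * dRow α η j := by
  have hmem : η i + 1 ∈ Icc 1 (η j) := by rw [mem_Icc]; omega
  have e0 : (η ∘ Equiv.swap i j) i = η j := by simp
  rw [dRow, e0, dRow, ← Finset.mul_prod_erase _ _ hmem, ← Finset.mul_prod_erase (Icc 1 (η j))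
    (fun c => α * (((η j : K) - (c : K)) + 1) + (leg η j c : K)) hmem, ← mul_assoc]
  congr 1
  · have h1 := leg_swap_left hij hlt (η i + 1)
    rw [if_pos rfl] at h1
    have h2 := leg_add_rk hij hlt
    have h1' : (leg η j (η i + 1) : K) = leg (η ∘ Equiv.swap i j) i (η i + 1) + 1 := by
      rw [h1, Nat.cast_succ]
    have h2' : (leg η j (η i + 1) : K) + rk η j = rk η i := by
      rw [← Nat.cast_add, h2]
    have hd := mul_inv_cancel₀ (sub_ne_zero.2 hne)
    have h3 : α * (((η j : K) - ((η i + 1 : ℕ) : K)) + 1) + (leg η j (η i + 1) : K) =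
        - (etaBar α η i - etaBar α η j) := by
      rw [etaBar_eq, etaBar_eq]
      push_cast
      linear_combination h2'
    rw [h3]
    linear_combination h3 + hd - h1'
  · refine Finset.prod_congr rfl fun c hc => ?_
    rw [leg_swap_left hij hlt c, if_neg (mem_erase.1 hc).1, add_zero]

lemma dPrime_swap (α : K) {η : Fin N → ℕ} {i j : Fin N} (hij : (i : ℕ) + 1 = j)
    (hlt : η i < η j) (hne : etaBar α η i ≠ etaBar α η j) :
    dPrime α (η ∘ Equiv.swap i j) = (1 + (etaBar α η i - etaBar α η j)⁻¹) * dPrime α η := by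
  have e : dPrime α η = ∏ k, dRow α η (Equiv.swap i j k) := by
    rw [dPrime_eq]
    exact (Equiv.prod_comp (Equiv.swap i j) (dRow α η)).symm
  rw [e, dPrime_eq, ← Finset.mul_prod_erase _ _ (mem_univ i), dRow_swap_left α hij hlt hne,
    ← Finset.mul_prod_erase univ (fun k => dRow α η (Equiv.swap i j k)) (mem_univ i),
    Equiv.swap_apply_left, mul_assoc]
  congr 2
  exact Finset.prod_congr rfl fun k hk => dRow_swap α hij hlt (mem_erase.1 hk).1

lemma dRow_phi_of_ne [NeZero N] (α : K) (η : Fin N → ℕ) {k : Fin N} (hk : k ≠ top) :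
    dRow α (phi η) k = dRow α η (rot k) := by
  have : phi η k = η (rot k) := by simp [phi, rot_eq_zero_iff, hk]
  simp only [dRow, leg_phi_of_ne η hk, this]

lemma prod_Icc_one_succ {M : Type*} [CommMonoid M] (f : ℕ → M) (n : ℕ) :
    ∏ c ∈ Icc 1 (n + 1), f c = f 1 * ∏ c ∈ Icc 1 n, f (c + 1) := by
  induction n with
  | zero => simp
  | succ n ih =>
    rw [Finset.prod_Icc_succ_top (by omega), ih, Finset.prod_Icc_succ_top (b := n) (by omega),
      mul_assoc]

lemma dRow_phi_top [NeZero N] (α : K) (η : Fin N → ℕ) :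
    dRow α (phi η) top = (etaBar α η 0 + α + ((N : K) - 1)) * dRow α η 0 := by
  have h0 : phi η top = η 0 + 1 := by simp [phi, rot_top]
  rw [dRow, h0, prod_Icc_one_succ, dRow]
  congr 1
  · have h := leg_zero_add_rk η
    have h' : (leg η 0 0 : K) + rk η 0 + 1 = N := by
      conv_rhs => rw [← h]
      push_cast
      rfl
    rw [leg_phi_top η 0, etaBar_eq]
    push_cast
    linear_combination h'
  · refine Finset.prod_congr rfl fun c _ => ?_
    rw [leg_phi_top]
    push_cast
    ring

lemma dPrime_phi [NeZero N] (α : K) (η : Fin N → ℕ) :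
    dPrime α (phi η) = (etaBar α η 0 + α + ((N : K) - 1)) * dPrime α η := by
  have e : dPrime α η = ∏ k, dRow α η (rot k) := by
    rw [dPrime_eq]
    exact (Equiv.prod_comp rot (dRow α η)).symm
  rw [e, dPrime_eq, ← Finset.mul_prod_erase _ _ (mem_univ top), dRow_phi_top,
    ← Finset.mul_prod_erase univ (fun k => dRow α η (rot k)) (mem_univ top), rot_top, mul_assoc]
  congr 2
  exact Finset.prod_congr rfl fun k hk => dRow_phi_of_ne α η (mem_erase.1 hk).1

/-- The factor of `e'_η` that comes from a row of length `m` with spectral value `x = η̄ᵢ/α`. -/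
noncomputable def eFac (N : ℕ) (α : K) (m : ℕ) (x : K) : K :=
  α ^ m * (ascPochhammer K m).eval (1 + ((N : K) - 1) / α + x - m)

lemma eFac_succ (N : ℕ) (α : K) (m : ℕ) (x : K) :
    eFac N α (m + 1) (x + 1) = α * (x + 1 + ((N : K) - 1) / α) * eFac N α m x := by
  rw [eFac, eFac, ascPochhammer_succ_eval]
  have : 1 + ((N : K) - 1) / α + (x + 1) - ((m + 1 : ℕ) : K) =
      1 + ((N : K) - 1) / α + x - m := by push_cast; ring
  rw [this]
  ring

/-- Row `i` stands in `η⁺` at index `rk η i`, and `-rk η i / α = η̄ᵢ/α - ηᵢ`. In this form `e'_η`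
visibly depends only on the multiset of pairs `(ηᵢ, η̄ᵢ/α)`. -/
lemma ePrime_eq {α : K} (hα : α ≠ 0) (η : Fin N → ℕ) :
    ePrime α η = ∏ i, eFac N α (η i) (etaBar α η i / α) := by
  rw [ePrime, genFactorial, ← Finset.prod_pow_eq_pow_sum,
    ← Equiv.prod_comp (rkEquiv η) (fun j => (ascPochhammer K (etaPlus η j)).eval
      (1 + ((N : K) - 1) / α - ((j : ℕ) : K) / α)), ← Finset.prod_mul_distrib]
  refine Finset.prod_congr rfl fun i _ => ?_
  rw [etaPlus_rkEquiv, coe_rkEquiv, eFac, etaBar_eq]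
  congr 2
  field_simp
  ring

lemma ePrime_swap {α : K} (hα : α ≠ 0) {η : Fin N → ℕ} {i j : Fin N} (hij : (i : ℕ) + 1 = j)
    (hne : η i ≠ η j) : ePrime α (η ∘ Equiv.swap i j) = ePrime α η := by
  rw [ePrime_eq hα, ePrime_eq hα]
  simp only [etaBar_swap α hij hne]
  exact Equiv.prod_comp (Equiv.swap i j) (fun k => eFac N α (η k) (etaBar α η k / α))

/-- The factor is the one in `dPrime_phi`, so the ratio `e'/d'` is invariant under `Φ`. -/
lemma ePrime_phi [NeZero N] {α : K} (hα : α ≠ 0) (η : Fin N → ℕ) :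
    ePrime α (phi η) = (etaBar α η 0 + α + ((N : K) - 1)) * ePrime α η := by
  have h1 : ∏ i, eFac N α (η i) (etaBar α η i / α) =
      ∏ i, eFac N α (η (rot i)) (etaBar α η (rot i) / α) :=
    (Equiv.prod_comp rot (fun k => eFac N α (η k) (etaBar α η k / α))).symm
  rw [ePrime_eq hα, ePrime_eq hα, h1, ← Finset.mul_prod_erase _ _ (mem_univ top),
    ← Finset.mul_prod_erase univ (fun i => eFac N α (η (rot i)) (etaBar α η (rot i) / α))
      (mem_univ top), ← mul_assoc]
  congr 1
  · simp only [etaBar_phi, phi, rot_top, if_true]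
    rw [add_div, div_self hα, eFac_succ]
    field_simp
  · refine Finset.prod_congr rfl fun k hk => ?_
    have hk : k ≠ top := (mem_erase.1 hk).1
    simp only [etaBar_phi, phi, rot_eq_zero_iff, hk, if_false, add_zero]

lemma ascPochhammer_eval_ne_zero {v : K} (h : ∀ k : ℕ, v + k ≠ 0) (m : ℕ) :
    (ascPochhammer K m).eval v ≠ 0 := by
  induction m with
  | zero => simp
  | succ m ih => rw [ascPochhammer_succ_eval]; exact mul_ne_zero ih (h m)

lemma ePrime_ne_zero [CharZero K] {α : K}
    (hα : ∀ m n : ℕ, 0 < m → (m : K) * α + (n : K) ≠ 0) (η : Fin N → ℕ) : ePrime α η ≠ 0 := by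
  have h0 := ne_zero_of_generic hα
  refine mul_ne_zero (pow_ne_zero _ h0) (Finset.prod_ne_zero_iff.2 fun j _ => ?_)
  refine ascPochhammer_eval_ne_zero (fun k h => ?_) _
  have hj := j.isLt
  have h1 := hα (k + 1) (N - 1 - j) (by omega)
  rw [Nat.cast_sub (by omega), Nat.cast_sub (by omega)] at h1
  apply h1
  field_simp at h
  push_cast
  linear_combination h

variable [NeZero N]

/-- The normalization `(e'_η / d'_η) E_η` of the non-symmetric Jack polynomial. -/
noncomputable def jackN (α : K) (η : Fin N → ℕ) : MvPolynomial (Fin N) K :=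
  (ePrime α η / dPrime α η) • jackE α η

variable [CharZero K] {α : K}

lemma raise_jackN (hα : ∀ m n : ℕ, 0 < m → (m : K) * α + (n : K) ≠ 0) (η : Fin N → ℕ) :
    raise (jackN α η) = jackN α (phi η) := by
  have h0 := dPrime_ne_zero hα (phi η)
  rw [jackN, map_smul, raise_jackE hα, jackN, ePrime_phi (ne_zero_of_generic hα), dPrime_phi] at *
  rw [mul_div_mul_left _ _ (left_ne_zero_of_mul h0)]

/-- The action of an adjacent transposition on `jackN`. -/
lemma swap_jackN (hα : ∀ m n : ℕ, 0 < m → (m : K) * α + (n : K) ≠ 0) (η : Fin N → ℕ)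
    {i j : Fin N} (hij : (i : ℕ) + 1 = j) :
    rename (Equiv.swap i j) (jackN α η) = (etaBar α η i - etaBar α η j)⁻¹ • jackN α η +
      (if η i = η j then 0 else 1 + (etaBar α η i - etaBar α η j)⁻¹) •
        jackN α (η ∘ Equiv.swap i j) := by
  have hij' : i ≠ j := by rintro rfl; omega
  have hne := (etaBar_injective hα η).ne hij'
  have hα0 := ne_zero_of_generic hα
  have hd := dPrime_ne_zero hα η
  have hd' := dPrime_ne_zero hα (η ∘ Equiv.swap i j)
  rw [jackN, map_smul]
  -- The ratio of the `d'` turns both coefficients `1` (ascent) and `1 - δ⁻²` (descent) into `1 +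
  -- δ⁻¹`; at equal entries `δ = 1`.
  rcases lt_trichotomy (η i) (η j) with h | h | h
  · rw [if_neg h.ne, swap_jackE_of_lt hα hij h, jackN, ePrime_swap hα0 hij h.ne, smul_add,
      ← smul_eq_C_mul, smul_comm, smul_smul (1 + _)]
    congr 2
    rw [dPrime_swap α hij h hne] at hd' ⊢
    have h1 := left_ne_zero_of_mul hd'
    rw [← mul_div_assoc, mul_div_mul_left _ _ h1]
  · rw [if_pos h, swap_jackE_of_eq hα hij h, etaBar_of_eq α hij h]
    simp
  · rw [if_neg h.ne', swap_jackE_of_gt hα hij h, jackN, ePrime_swap hα0 hij h.ne', smul_add,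
      ← smul_eq_C_mul, smul_comm, smul_smul (1 + _), ← smul_eq_C_mul, smul_smul _ (1 - _)]
    congr 2
    have h1 := dPrime_swap α (η := η ∘ Equiv.swap i j) hij (by simpa using h)
      (by rw [etaBar_swap α hij h.ne', etaBar_swap α hij h.ne']; simpa using hne.symm)
    rw [comp_swap_swap, etaBar_swap α hij h.ne', etaBar_swap α hij h.ne', Equiv.swap_apply_left,
      Equiv.swap_apply_right, ← neg_sub (etaBar α η i), inv_neg] at h1
    rw [div_mul_eq_mul_div, ← mul_div_assoc, div_eq_div_iff hd hd', h1]
    ring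

end Norms

/-! ### Cyclic successors, maximality and injectivity of `c_I`. -/

section CyclicSuccessor

variable {N : ℕ}

/-- `k` is the smallest element of `I` that exceeds `j`. -/
def IsNext (I : Finset (Fin N)) (j k : Fin N) : Prop :=
  k ∈ I ∧ j < k ∧ ∀ l ∈ I, j < l → k ≤ l

lemma exists_isNext {I : Finset (Fin N)} {j l : Fin N} (hl : l ∈ I) (hjl : j < l) :
    ∃ k, IsNext I j k := by
  have h : (I.filter (j < ·)).Nonempty := ⟨l, mem_filter.2 ⟨hl, hjl⟩⟩
  have h1 := mem_filter.1 (Finset.min'_mem _ h)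
  exact ⟨_, h1.1, h1.2, fun m hm hjm => Finset.min'_le _ _ (mem_filter.2 ⟨hm, hjm⟩)⟩

lemma isNext_or_forall_le (I : Finset (Fin N)) (j : Fin N) :
    (∃ k, IsNext I j k) ∨ ∀ l ∈ I, l ≤ j := by
  by_cases h : ∃ l ∈ I, j < l
  · obtain ⟨l, hl, hjl⟩ := h
    exact Or.inl (exists_isNext hl hjl)
  · exact Or.inr (by push Not at h; exact h)

lemma IsNext.next_eq {I : Finset (Fin N)} {j k : Fin N} (h : IsNext I j k) : next I j = k := by
  have hne : (I.filter (j < ·)).Nonempty := ⟨k, mem_filter.2 ⟨h.1, h.2.1⟩⟩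
  rw [next, dif_pos hne]
  apply le_antisymm
  · exact Finset.min'_le _ _ (mem_filter.2 ⟨h.1, h.2.1⟩)
  · have h1 := mem_filter.1 (Finset.min'_mem _ hne)
    exact h.2.2 _ h1.1 h1.2

variable [NeZero N]

lemma first_mem {I : Finset (Fin N)} (h : I.Nonempty) : first I ∈ I := by
  rw [first, dif_pos h]; exact Finset.min'_mem _ _

lemma first_le {I : Finset (Fin N)} {j : Fin N} (h : j ∈ I) : first I ≤ j := by
  rw [first, dif_pos ⟨j, h⟩]; exact Finset.min'_le _ _ h

lemma first_eq {I : Finset (Fin N)} {k : Fin N} (hk : k ∈ I) (h : ∀ l ∈ I, k ≤ l) : first I = k :=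
  le_antisymm (first_le hk) (h _ (first_mem ⟨k, hk⟩))

lemma last_mem {I : Finset (Fin N)} (h : I.Nonempty) : last I ∈ I := by
  rw [last, dif_pos h]; exact Finset.max'_mem _ _

lemma le_last {I : Finset (Fin N)} {j : Fin N} (h : j ∈ I) : j ≤ last I := by
  rw [last, dif_pos ⟨j, h⟩]; exact Finset.le_max' _ _ h

/-- The value of `f` at the element of `I` that follows `j` cyclically; it is increased by one when
the end of the sequence is passed. -/
def succVal {β : Type*} [Add β] [One β] (I : Finset (Fin N)) (f : Fin N → β) (j : Fin N) : β :=
  if ∃ l ∈ I, j < l then f (next I j) else f (first I) + 1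

lemma succVal_of_isNext {β : Type*} [Add β] [One β] {I : Finset (Fin N)} {j k : Fin N}
    (h : IsNext I j k) (f : Fin N → β) : succVal I f j = f k := by
  rw [succVal, if_pos ⟨k, h.1, h.2.1⟩, h.next_eq]

lemma succVal_of_forall_le {β : Type*} [Add β] [One β] {I : Finset (Fin N)} {j : Fin N}
    (h : ∀ l ∈ I, l ≤ j) (f : Fin N → β) : succVal I f j = f (first I) + 1 := by
  rw [succVal, if_neg]
  rintro ⟨l, hl, hjl⟩
  exact absurd (h l hl) (not_le.2 hjl)

lemma succVal_congr {β : Type*} [Add β] [One β] {I J : Finset (Fin N)} {j : Fin N}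
    (h : ∀ l, j < l → (l ∈ I ↔ l ∈ J)) {k : Fin N} (hk : k ∈ I) (hjk : j < k) (f : Fin N → β) :
    succVal I f j = succVal J f j := by
  obtain ⟨m, hm⟩ := exists_isNext hk hjk
  have hm' : IsNext J j m :=
    ⟨(h m hm.2.1).1 hm.1, hm.2.1, fun l hl hjl => hm.2.2 l ((h l hjl).2 hl) hjl⟩
  rw [succVal_of_isNext hm, succVal_of_isNext hm']

/-- The extension of `cI` to functions with values in any type. -/
def cycleFun {β : Type*} [Add β] [One β] (I : Finset (Fin N)) (f : Fin N → β) : Fin N → β :=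
  fun j => if j ∈ I then succVal I f j else f j

lemma succVal_last {β : Type*} [Add β] [One β] (I : Finset (Fin N)) (f : Fin N → β) :
    succVal I f (last I) = f (first I) + 1 :=
  succVal_of_forall_le (fun _ hl => le_last hl) f

lemma succVal_of_lt_last {β : Type*} [Add β] [One β] {I : Finset (Fin N)} (hI : I.Nonempty)
    {j : Fin N} (h : j < last I) (f : Fin N → β) : succVal I f j = f (next I j) := by
  rw [succVal, if_pos ⟨_, last_mem hI, h⟩]

lemma lt_last_of_mem {I : Finset (Fin N)} {j : Fin N} (h : j ∈ I) (hne : j ≠ last I) :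
    j < last I := lt_of_le_of_ne (le_last h) hne

lemma cI_eq_cycleFun (I : Finset (Fin N)) (η : Fin N → ℕ) : cI I η = cycleFun I η := by
  ext j
  rw [cI, cycleFun]
  split_ifs with h1 h2
  · rw [h2, succVal_last]
  · rw [succVal_of_lt_last ⟨j, h1⟩ (lt_last_of_mem h1 h2)]
  · rfl

/-- The shift of an affine sequence: the entry that leaves on the left returns on the right,
increased by one. -/
def rotFun {β : Type*} [AddMonoidWithOne β] (f : Fin N → β) : Fin N → β :=
  fun i => f (rot i) + if rot i = 0 then 1 else 0

lemma phi_eq_rotFun (η : Fin N → ℕ) : phi η = rotFun η := rfl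

lemma mem_map_rot {I : Finset (Fin N)} {j : Fin N} :
    j ∈ I.map rot.symm.toEmbedding ↔ rot j ∈ I := by
  simp [Finset.mem_map_equiv]

/-- As an affine sequence with `f (j + N) = f j + 1`, the successor commutes with translation. The
cases record where the walk from `j` to its successor crosses the boundary before and after the
shift. -/
lemma succVal_rot {β : Type*} [AddMonoidWithOne β] {I : Finset (Fin N)} (hI : I.Nonempty)
    (f : Fin N → β) (j : Fin N) :
    succVal (I.map rot.symm.toEmbedding) (rotFun f) j =
      succVal I f (rot j) + if rot j = 0 then 1 else 0 := by
  have hz : ∀ m : Fin N, (m : ℕ) = 0 ↔ m = 0 := fun m => by rw [Fin.ext_iff, coe_zero']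
  have hR : ∀ m : Fin N, rotFun f (rot.symm m) = f m + if m = 0 then 1 else 0 := fun m => by
    simp [rotFun]
  have hlt := fun m : Fin N => zero_lt_rot (k := m)
  by_cases hj : j = top
  · subst hj
    have hle : ∀ l ∈ I.map rot.symm.toEmbedding, l ≤ (top : Fin N) := fun l _ => by
      have := l.isLt
      have := coe_top (N := N)
      rw [Fin.le_def]; omega
    rw [succVal_of_forall_le hle, rot_top, if_pos rfl]
    congr 1
    rcases isNext_or_forall_le I 0 with ⟨k, hk⟩ | h0
    · rw [succVal_of_isNext hk]
      have hk0 : k ≠ 0 := hk.2.1.ne'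
      have : first (I.map rot.symm.toEmbedding) = rot.symm k := by
        refine first_eq (by rw [mem_map_rot]; simpa using hk.1) fun l hl => ?_
        rw [mem_map_rot] at hl
        by_cases hlt' : l = top
        · rw [hlt']; exact hle _ (by rw [mem_map_rot]; simpa using hk.1)
        · have h1 := hk.2.2 _ hl (hlt l hlt')
          by_contra h2
          rw [not_le, ← rot_lt_rot_iff (by rw [Ne, ← rot_eq_zero_iff]; simpa using hk0) hlt',
            Equiv.apply_symm_apply] at h2
          exact absurd h1 (not_le.2 h2)
      rw [this, hR, if_neg hk0, add_zero]
    · have hI0 : ∀ l ∈ I, l = 0 := fun l hl => by simpa using h0 l hl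
      obtain ⟨l, hl⟩ := hI
      have hl0 := hI0 l hl
      subst hl0
      rw [succVal_of_forall_le h0, first_eq hl (by simp), first_eq (k := top)
        (by rw [mem_map_rot, rot_top]; exact hl)]
      · have := hR 0
        rwa [if_pos rfl] at this
      · intro l hl
        rw [mem_map_rot] at hl
        rw [(rot_eq_zero_iff l).1 (hI0 _ hl)]
  · have hj0 : rot j ≠ 0 := by rwa [Ne, rot_eq_zero_iff]
    rw [if_neg hj0, add_zero]
    rcases isNext_or_forall_le I (rot j) with ⟨k, hk⟩ | hle
    · have hk0 : k ≠ 0 := (lt_of_le_of_lt (Fin.zero_le _) hk.2.1).ne'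
      have hkt : rot.symm k ≠ top := by rw [Ne, ← rot_eq_zero_iff]; simpa using hk0
      have : IsNext (I.map rot.symm.toEmbedding) j (rot.symm k) := by
        refine ⟨by rw [mem_map_rot]; simpa using hk.1, ?_, fun l hl hjl => ?_⟩
        · rw [← rot_lt_rot_iff hkt hj]
          simpa using hk.2.1
        · rw [mem_map_rot] at hl
          by_cases hlt' : l = top
          · rw [hlt']; exact (lt_top' hkt).le
          · by_contra h2
            rw [not_le, ← rot_lt_rot_iff hkt hlt', Equiv.apply_symm_apply] at h2
            exact absurd (hk.2.2 _ hl ((rot_lt_rot_iff hlt' hj).2 hjl)) (not_le.2 h2)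
      rw [succVal_of_isNext this, succVal_of_isNext hk, hR, if_neg hk0, add_zero]
    · rw [succVal_of_forall_le hle]
      have hlt2 : ∀ l ∈ I.map rot.symm.toEmbedding, l ≠ top → l ≤ j := fun l hl hlt' => by
        rw [mem_map_rot] at hl
        by_contra h2
        rw [not_le, ← rot_lt_rot_iff hlt' hj] at h2
        exact absurd (hle _ hl) (not_le.2 h2)
      by_cases h0 : (0 : Fin N) ∈ I
      · have : IsNext (I.map rot.symm.toEmbedding) j top := by
          refine ⟨by rw [mem_map_rot, rot_top]; exact h0, lt_top' hj, fun l hl hjl => ?_⟩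
          by_contra h2
          exact absurd (hlt2 l hl (fun h => h2 h.ge)) (not_le.2 hjl)
        rw [succVal_of_isNext this, first_eq h0 (by simp)]
        have := hR 0
        rwa [if_pos rfl] at this
      · have hfI := first_mem hI
        have hf0 : first I ≠ 0 := fun h => h0 (h ▸ hfI)
        have hft : rot.symm (first I) ≠ top := by rw [Ne, ← rot_eq_zero_iff]; simpa using hf0
        have hne : ∀ l ∈ I.map rot.symm.toEmbedding, l ≠ top := fun l hl hlt' => by
          rw [mem_map_rot, hlt', rot_top] at hl
          exact h0 hl
        rw [succVal_of_forall_le fun l hl => hlt2 l hl (hne l hl)]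
        have : first (I.map rot.symm.toEmbedding) = rot.symm (first I) := by
          refine first_eq (by rw [mem_map_rot]; simpa using hfI) fun l hl => ?_
          by_contra h2
          rw [not_le, ← rot_lt_rot_iff hft (hne l hl), Equiv.apply_symm_apply] at h2
          rw [mem_map_rot] at hl
          exact absurd (first_le hl) (not_le.2 h2)
        rw [this, hR, if_neg hf0, add_zero]

lemma cycleFun_rot {β : Type*} [AddMonoidWithOne β] {I : Finset (Fin N)} (hI : I.Nonempty)
    (f : Fin N → β) :
    cycleFun (I.map rot.symm.toEmbedding) (rotFun f) = rotFun (cycleFun I f) := by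
  ext j
  rw [cycleFun, succVal_rot hI, rotFun, rotFun, cycleFun]
  simp only [mem_map_rot]
  split_ifs <;> rfl

lemma rotFun_injective {β : Type*} [AddGroupWithOne β] :
    Function.Injective (rotFun : (Fin N → β) → Fin N → β) := by
  intro f g h
  ext i
  have := congrFun h (rot.symm i)
  simpa [rotFun] using this

/-- A position outside `I` lies either in the gap below its successor in `I` or beyond `last I`, so
both clauses of maximality become one shift-invariant condition. -/
lemma isMaximal_iff {η : Fin N → ℕ} {I : Finset (Fin N)} :
    IsMaximal η I ↔ I.Nonempty ∧ ∀ j ∉ I, η j ≠ succVal I η j := by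
  unfold IsMaximal
  refine and_congr_right fun hI => ⟨fun ⟨h1, h2⟩ j hj => ?_, fun h => ⟨fun t ht j hj => ?_, fun j hj => ?_⟩⟩
  · rcases isNext_or_forall_le I j with ⟨k, hk⟩ | hle
    · rw [succVal_of_isNext hk]
      refine h1 k hk.1 j (mem_filter.2 ⟨mem_Iio.2 hk.2.1, fun l hl hlk => ?_⟩)
      by_contra h3
      rw [not_lt] at h3
      have : j ≠ l := by rintro rfl; exact hj hl
      exact absurd (hk.2.2 l hl (lt_of_le_of_ne h3 this)) (not_le.2 hlk)
    · rw [succVal_of_forall_le hle]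
      refine h2 j (mem_Ioi.2 (lt_of_le_of_ne (hle _ (last_mem hI)) ?_))
      rintro rfl
      exact hj (last_mem hI)
  · rw [gapBelow, mem_filter, mem_Iio] at hj
    have hn : IsNext I j t := ⟨ht, hj.1, fun l hl hjl => by
      by_contra h3
      exact lt_asymm hjl (hj.2 l hl (not_le.1 h3))⟩
    rw [← succVal_of_isNext hn η]
    exact h j fun hjI => lt_irrefl _ (hj.2 j hjI hj.1)
  · rw [mem_Ioi] at hj
    have hle : ∀ l ∈ I, l ≤ j := fun l hl => (le_last hl).trans hj.le
    rw [← succVal_of_forall_le hle η]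
    exact h j fun hjI => absurd (le_last hjI) (not_le.2 hj)

lemma isNext_next {I : Finset (Fin N)} {t : Fin N} (ht : t ∈ I) (hne : t ≠ last I) :
    IsNext I t (next I t) := by
  obtain ⟨k, hk⟩ := exists_isNext (last_mem ⟨t, ht⟩) (lt_last_of_mem ht hne)
  rwa [hk.next_eq]

/-- `next I` maps `I` without its last element bijectively onto `I` without its first. -/
lemma prod_next {M : Type*} [CommMonoid M] {I : Finset (Fin N)} (hI : I.Nonempty)
    (g : Fin N → M) : (∏ t ∈ I.erase (last I), g (next I t)) * g (first I) = ∏ t ∈ I, g t := by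
  have hinj : Set.InjOn (next I) (I.erase (last I)) := by
    intro s hs t ht h
    rw [Finset.mem_coe, mem_erase] at hs ht
    have h1 := isNext_next hs.2 hs.1
    have h2 := isNext_next ht.2 ht.1
    by_contra hne
    rcases lt_or_gt_of_ne hne with hlt | hlt
    · exact absurd (h1.2.2 t ht.2 hlt) (not_le.2 (by rw [h]; exact h2.2.1))
    · exact absurd (h2.2.2 s hs.2 hlt) (not_le.2 (by rw [← h]; exact h1.2.1))
  have himg : (I.erase (last I)).image (next I) = I.erase (first I) := by
    apply Finset.eq_of_subset_of_card_le
    · intro k hk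
      obtain ⟨t, ht, rfl⟩ := mem_image.1 hk
      rw [mem_erase] at ht ⊢
      have h1 := isNext_next ht.2 ht.1
      exact ⟨(lt_of_le_of_lt (first_le ht.2) h1.2.1).ne', h1.1⟩
    · rw [Finset.card_image_of_injOn hinj, Finset.card_erase_of_mem (last_mem hI),
        Finset.card_erase_of_mem (first_mem hI)]
  rw [← Finset.prod_image hinj, himg, Finset.prod_erase_mul _ _ (first_mem hI)]

/-- A product over the entries of `cycleFun I f` in terms of the entries of `f`. -/
lemma prod_cycleFun {M β γ : Type*} [CommMonoid M] [Add β] [One β] [Add γ] [One γ]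
    {I : Finset (Fin N)} (hI : I.Nonempty) (f : Fin N → β) (f' : Fin N → γ) (g : β → γ → M) :
    (∏ j, g (cycleFun I f j) (cycleFun I f' j)) * g (f (first I)) (f' (first I)) =
      (∏ j, g (f j) (f' j)) * g (f (first I) + 1) (f' (first I) + 1) := by
  have h1 : ∏ j ∈ I, g (cycleFun I f j) (cycleFun I f' j) =
      (∏ j ∈ I.erase (last I), g (f (next I j)) (f' (next I j))) *
        g (f (first I) + 1) (f' (first I) + 1) := by
    rw [← Finset.prod_erase_mul _ _ (last_mem hI)]
    congr 1
    · refine Finset.prod_congr rfl fun j hj => ?_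
      rw [mem_erase] at hj
      have h := lt_last_of_mem hj.2 hj.1
      rw [cycleFun, cycleFun, if_pos hj.2, if_pos hj.2, succVal_of_lt_last hI h,
        succVal_of_lt_last hI h]
    · rw [cycleFun, cycleFun, if_pos (last_mem hI), if_pos (last_mem hI), succVal_last,
        succVal_last]
  have h2 : ∏ j ∈ univ \ I, g (cycleFun I f j) (cycleFun I f' j) =
      ∏ j ∈ univ \ I, g (f j) (f' j) :=
    Finset.prod_congr rfl fun j hj => by
      rw [cycleFun, cycleFun, if_neg (mem_sdiff.1 hj).2, if_neg (mem_sdiff.1 hj).2]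
  rw [← Finset.prod_sdiff (subset_univ I), h1, h2, ← Finset.prod_sdiff (subset_univ I),
    ← prod_next hI (fun j => g (f j) (f' j))]
  simp only [mul_comm, mul_left_comm]

lemma sum_cycleFun {M β : Type*} [AddCommMonoid M] [Add β] [One β]
    {I : Finset (Fin N)} (hI : I.Nonempty) (f : Fin N → β) (g : β → M) :
    (∑ j, g (cycleFun I f j)) + g (f (first I)) = (∑ j, g (f j)) + g (f (first I) + 1) :=
  prod_cycleFun (M := Multiplicative M) hI f f (fun a _ => g a)

/-- Passing to `c_I(η)` raises the sum of squares by `2 η_{t₁} + 1`, so `η_{t₁}` is determined. If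
the first elements differed, the smaller would lie in the initial gap of the other set with a
forbidden value. -/
lemma first_eq_of_cI_eq {η : Fin N → ℕ} {I J : Finset (Fin N)} (hI : IsMaximal η I)
    (hJ : IsMaximal η J) (h : cI I η = cI J η) : first I = first J := by
  rw [isMaximal_iff] at hI hJ
  rw [cI_eq_cycleFun, cI_eq_cycleFun] at h
  have h1 := sum_cycleFun hI.1 η (fun m => m ^ 2)
  have h2 := sum_cycleFun hJ.1 η (fun m => m ^ 2)
  rw [h] at h1
  have hv : η (first I) = η (first J) := by
    nlinarith
  have key : ∀ A B : Finset (Fin N), A.Nonempty → B.Nonempty →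
      η (first A) = η (first B) → (∀ j ∉ B, η j ≠ succVal B η j) → first B ≤ first A := by
    intro A B _ hB hv hmax
    by_contra hlt
    rw [not_le] at hlt
    have hn : IsNext B (first A) (first B) := ⟨first_mem hB, hlt, fun l hl _ => first_le hl⟩
    refine hmax (first A) (fun hm => absurd (first_le hm) (not_le.2 hlt)) ?_
    rw [succVal_of_isNext hn, hv]
  exact le_antisymm (key J I hJ.1 hI.1 hv.symm hI.2) (key I J hI.1 hJ.1 hv hJ.2)

/-- A maximal set is determined by the composition that it produces. -/
lemma cI_injOn {η : Fin N → ℕ} {I J : Finset (Fin N)} (hI : IsMaximal η I)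
    (hJ : IsMaximal η J) (h : cI I η = cI J η) : I = J := by
  have hf := first_eq_of_cI_eq hI hJ h
  rw [isMaximal_iff] at hI hJ
  rw [cI_eq_cycleFun, cI_eq_cycleFun] at h
  -- At a first disagreement `j ∈ A \ B`, the element `t` of `A` before `j` is also in `B`.
  -- Comparing both compositions at `t` shows that `η j` is the successor value of `j` in `B`,
  -- against maximality.
  have step : ∀ A B : Finset (Fin N), A.Nonempty → B.Nonempty → first A = first B →
      cycleFun A η = cycleFun B η → (∀ j ∉ B, η j ≠ succVal B η j) → ∀ j,
      (∀ l < j, l ∈ A ↔ l ∈ B) → j ∈ A → j ∈ B := by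
    intro A B hA hB hf h hmax j hj hjA
    by_contra hjB
    have hfj : first A < j := lt_of_le_of_ne (first_le hjA) (by
      rintro rfl
      rw [hf] at hjB
      exact hjB (first_mem hB))
    have hne : (A.filter (· < j)).Nonempty := ⟨first A, mem_filter.2 ⟨first_mem hA, hfj⟩⟩
    obtain ⟨t, ht, hmt⟩ := Finset.exists_max_image _ id hne
    rw [mem_filter] at ht
    simp only [mem_filter, id, and_imp] at hmt
    have htB := (hj t ht.2).1 ht.1
    have hn : IsNext A t j := ⟨hjA, ht.2, fun l hl htl => by
      by_contra hlj
      exact absurd (hmt l hl (not_le.1 hlj)) (not_le.2 htl)⟩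
    have h1 := congrFun h t
    rw [cycleFun, cycleFun, if_pos ht.1, if_pos htB, succVal_of_isNext hn] at h1
    refine hmax j hjB (h1.trans ?_)
    have hB' : ∀ l ∈ B, t < l → j < l := fun l hl htl => by
      rcases lt_trichotomy l j with hlj | rfl | hlj
      · exact absurd (hmt l ((hj l hlj).2 hl) hlj) (not_le.2 htl)
      · exact absurd hl hjB
      · exact hlj
    rcases isNext_or_forall_le B j with ⟨k, hk⟩ | hle
    · have hk' : IsNext B t k :=
        ⟨hk.1, ht.2.trans hk.2.1, fun l hl htl => hk.2.2 l hl (hB' l hl htl)⟩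
      rw [succVal_of_isNext hk, succVal_of_isNext hk']
    · rw [succVal_of_forall_le hle, succVal_of_forall_le fun l hl => ?_]
      by_contra htl
      exact absurd (hle l hl) (not_le.2 (hB' l hl (not_le.1 htl)))
  have key : ∀ n : ℕ, ∀ j : Fin N, (j : ℕ) = n → (j ∈ I ↔ j ∈ J) := by
    intro n
    induction n using Nat.strong_induction_on with
    | _ n ih =>
      intro j hjn
      have hlow : ∀ l < j, l ∈ I ↔ l ∈ J := fun l hl => ih l (by rw [← hjn]; exact hl) l rfl
      exact ⟨step I J hI.1 hJ.1 hf h hJ.2 j hlow,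
        step J I hJ.1 hI.1 hf.symm h.symm hI.2 j fun l hl => (hlow l hl).symm⟩
  ext j
  exact key j j rfl

end CyclicSuccessor

/-! ### Carrying an entry from right to left. -/

section Sweep

variable {N : ℕ} [NeZero N]

lemma top_induction {P : Fin N → Prop} (h0 : P top)
    (hs : ∀ q p : Fin N, (q : ℕ) + 1 = p → P p → P q) (p : Fin N) : P p := by
  have h : ∀ k : ℕ, ∀ p : Fin N, (p : ℕ) + k + 1 = N → P p := by
    intro k
    induction k with
    | zero =>
      intro p hp
      have : p = top := Fin.ext (by have := coe_top (N := N); omega)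
      rwa [this]
    | succ k ih =>
      intro p hp
      exact hs p ⟨p + 1, by omega⟩ rfl (ih _ (by simp; omega))
  exact h (N - 1 - p) p (by omega)

lemma Ico_top_eq_insert {q p : Fin N} (h : (q : ℕ) + 1 = p) :
    Ico q (top : Fin N) = insert q (Ico p top) := by
  have := coe_top (N := N)
  have := p.isLt
  ext j
  simp only [mem_Ico, mem_insert, Fin.ext_iff, Fin.le_def, Fin.lt_def]
  omega

lemma notMem_Ico_succ {q p : Fin N} (h : (q : ℕ) + 1 = p) : q ∉ Ico p (top : Fin N) := by
  simp only [mem_Ico, Fin.le_def]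
  omega

lemma rot_eq_of_succ {q p : Fin N} (h : (q : ℕ) + 1 = p) : rot q = p := by
  have h1 := coe_rot q
  have := p.isLt
  rw [if_neg (by omega)] at h1
  exact Fin.ext (by omega)

/-- The sequence in which the entry at the first element of `I` is carried to position `p` and the
entries from `p` on have been moved to the right according to `I`. -/
def carry {β : Type*} [Add β] [One β] (p : Fin N) (I : Finset (Fin N)) (f : Fin N → β) :
    Fin N → β :=
  fun j => if j < p then f j else if j = p then f (first I) else cycleFun I f (rot.symm j)

lemma carry_top {β : Type*} [Add β] [One β] (f : Fin N → β) : carry top {top} f = f := by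
  ext j
  rw [carry]
  split_ifs with h1 h2
  · rfl
  · rw [first_eq (mem_singleton_self _) (by simp), h2]
  · exact absurd (lt_top' h2) h1

lemma carry_of_lt {β : Type*} [Add β] [One β] {q p : Fin N} (h : q < p) (I : Finset (Fin N))
    (f : Fin N → β) : carry p I f q = f q := by
  rw [carry, if_pos h]

lemma carry_self {β : Type*} [Add β] [One β] (p : Fin N) (I : Finset (Fin N))
    (f : Fin N → β) : carry p I f p = f (first I) := by
  rw [carry, if_neg (lt_irrefl p), if_pos rfl]

/-- For `q ∉ I` the carried entry moves past the entry at `q`. -/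
lemma carry_gap {β : Type*} [Add β] [One β] {q p : Fin N} (h : (q : ℕ) + 1 = p)
    {I : Finset (Fin N)} (hI : ∀ l ∈ I, p ≤ l) (f : Fin N → β) :
    carry q I f = carry p I f ∘ Equiv.swap q p := by
  have hqp : q < p := by rw [Fin.lt_def]; omega
  ext j
  rw [Function.comp]
  rcases lt_trichotomy j q with hj | rfl | hj
  · rw [Equiv.swap_apply_of_ne_of_ne hj.ne (hj.trans hqp).ne, carry_of_lt hj,
      carry_of_lt (hj.trans hqp)]
  · rw [Equiv.swap_apply_left, carry_self, carry_self]
  · rcases eq_or_ne j p with rfl | hne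
    · rw [Equiv.swap_apply_right, carry_of_lt hqp, carry, if_neg (not_lt.2 hj.le), if_neg hj.ne',
        ← rot_eq_of_succ h, Equiv.symm_apply_apply, cycleFun,
        if_neg fun hm => absurd (hI _ hm) (not_le.2 hqp)]
    · rw [Equiv.swap_apply_of_ne_of_ne hj.ne' hne, carry, carry, if_neg (not_lt.2 hj.le),
        if_neg hj.ne', if_neg (by rw [not_lt, Fin.le_def]; rw [Fin.lt_def] at hj; omega),
        if_neg hne]

lemma isNext_first {q p : Fin N} (h : (q : ℕ) + 1 = p) {I : Finset (Fin N)}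
    (hI : ∀ l ∈ I, p ≤ l) (hne : I.Nonempty) : IsNext I q (first I) := by
  have hf := hI _ (first_mem hne)
  refine ⟨first_mem hne, ?_, fun l hl _ => first_le hl⟩
  rw [Fin.le_def] at hf
  rw [Fin.lt_def]; omega

lemma isNext_insert_first {q p : Fin N} (h : (q : ℕ) + 1 = p) {I : Finset (Fin N)}
    (hI : ∀ l ∈ I, p ≤ l) (hne : I.Nonempty) : IsNext (insert q I) q (first I) := by
  have hn := isNext_first h hI hne
  refine ⟨mem_insert_of_mem hn.1, hn.2.1, fun l hl hql => ?_⟩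
  rcases mem_insert.1 hl with rfl | hl
  · exact absurd hql (lt_irrefl _)
  · exact first_le hl

lemma succVal_insert {β : Type*} [Add β] [One β] {q p : Fin N} (h : (q : ℕ) + 1 = p)
    {I : Finset (Fin N)} (htop : top ∈ I) (f : Fin N → β) {j : Fin N} (hpj : p ≤ j)
    (hj : j < top) : succVal (insert q I) f j = succVal I f j := by
  refine (succVal_congr (fun l hl => ?_) htop hj f).symm
  have : l ≠ q := by
    rintro rfl
    rw [Fin.le_def] at hpj
    rw [Fin.lt_def] at hl
    omega
  simp [this]

/-- When `q` joins `I`, the carried entry is left at `p` and the entry at `q` is carried on: the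
sequence is the same, only its description changes. -/
lemma carry_insert {β : Type*} [Add β] [One β] {q p : Fin N} (h : (q : ℕ) + 1 = p)
    {I : Finset (Fin N)} (hI : ∀ l ∈ I, p ≤ l) (htop : top ∈ I) (f : Fin N → β) :
    carry q (insert q I) f = carry p I f := by
  have hqp : q < p := by rw [Fin.lt_def]; omega
  ext j
  rcases lt_trichotomy j q with hj | rfl | hj
  · rw [carry_of_lt hj, carry_of_lt (hj.trans hqp)]
  · rw [carry_self, carry_of_lt hqp, first_eq (mem_insert_self _ _)]
    intro l hl
    rcases mem_insert.1 hl with rfl | hl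
    · exact le_rfl
    · exact hqp.le.trans (hI l hl)
  · rcases eq_or_ne j p with rfl | hne
    · rw [carry_self, carry, if_neg (not_lt.2 hj.le), if_neg hj.ne',
        ← rot_eq_of_succ h, Equiv.symm_apply_apply, cycleFun, if_pos (mem_insert_self _ _),
        succVal_of_isNext (isNext_insert_first h hI ⟨_, htop⟩)]
    · have hpj : p < j := by
        rw [Fin.lt_def] at hj ⊢
        have : (j : ℕ) ≠ p := fun h => hne (Fin.ext h)
        omega
      rw [carry, carry, if_neg (not_lt.2 hj.le), if_neg hj.ne', if_neg (not_lt.2 hpj.le),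
        if_neg hne]
      obtain ⟨m, rfl⟩ := rot.surjective j
      rw [Equiv.symm_apply_apply]
      have hmt : m ≠ top := by
        rintro rfl
        rw [rot_top] at hpj
        exact absurd hpj (not_lt.2 (Fin.zero_le _))
      have hpm : p ≤ m := by
        have h1 := coe_rot m
        have := coe_top (N := N)
        have : (m : ℕ) ≠ (top : Fin N) := fun h => hmt (Fin.ext h)
        rw [if_neg (by omega)] at h1
        rw [Fin.lt_def] at hpj
        rw [Fin.le_def]
        omega
      have hmq : m ≠ q := by rintro rfl; exact absurd hqp (not_lt.2 hpm)
      rw [cycleFun, cycleFun, succVal_insert h htop f hpm (lt_top' hmt)]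
      simp [hmq]

lemma rotFun_carry_zero {β : Type*} [AddMonoidWithOne β] {I : Finset (Fin N)} (htop : top ∈ I)
    (f : Fin N → β) : rotFun (carry 0 I f) = cycleFun I f := by
  ext j
  rw [rotFun]
  rcases eq_or_ne j top with rfl | hj
  · rw [rot_top, if_pos rfl, carry_self, cycleFun, if_pos htop, succVal_of_forall_le]
    intro l _
    have := l.isLt
    have := coe_top (N := N)
    rw [Fin.le_def]; omega
  · have h0 := zero_lt_rot hj
    rw [if_neg h0.ne', add_zero, carry, if_neg (not_lt.2 h0.le), if_neg h0.ne',
      Equiv.symm_apply_apply]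

lemma le_of_mem_insert_top {p : Fin N} {T : Finset (Fin N)} (hT : T ⊆ Ico p top) :
    ∀ l ∈ insert top T, p ≤ l := by
  intro l hl
  rcases mem_insert.1 hl with rfl | hl
  · have := p.isLt
    have := coe_top (N := N)
    rw [Fin.le_def]; omega
  · exact (mem_Ico.1 (hT hl)).1

end Sweep

/-! ### The expansion of the product with one variable. -/

section Expansion

variable {K : Type*} [Field K] {N : ℕ}

/-- The spectral vector `η̄/α`. -/
noncomputable def spec (α : K) (η : Fin N → ℕ) : Fin N → K := fun k => etaBar α η k / α

lemma spec_swap (α : K) {η : Fin N → ℕ} {i j : Fin N} (hij : (i : ℕ) + 1 = j)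
    (h : η i ≠ η j) : spec α (η ∘ Equiv.swap i j) = spec α η ∘ Equiv.swap i j := by
  ext k
  rw [spec, etaBar_swap α hij h, Function.comp, spec]

lemma spec_injective [CharZero K] {α : K}
    (hα : ∀ m n : ℕ, 0 < m → (m : K) * α + (n : K) ≠ 0) (η : Fin N → ℕ) :
    Function.Injective (spec α η) := by
  intro i j h
  exact etaBar_injective hα η ((div_left_inj' (ne_zero_of_generic hα)).1 h)

variable [NeZero N]

/-- The factor that the position `j` contributes to the coefficient belonging to `I`. -/
noncomputable def weight (α : K) (I : Finset (Fin N)) (η : Fin N → ℕ) (x : Fin N → K)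
    (j : Fin N) : K :=
  if j ∈ I then fa α (x j) (succVal I x j)
  else if η j = succVal I η j then 0 else fb α (succVal I x j) (x j)

lemma spec_phi {α : K} (hα : α ≠ 0) (η : Fin N → ℕ) : spec α (phi η) = rotFun (spec α η) := by
  ext k
  rw [spec, etaBar_phi, rotFun, spec]
  split_ifs
  · rw [add_div, div_self hα]
  · simp

lemma raise_injective : Function.Injective (raise : MvPolynomial (Fin N) K → _) := by
  intro f g h
  rw [raise_apply, raise_apply] at h
  exact rename_injective _ rot.symm.injective (mul_left_cancel₀ (X_ne_zero _) h)

lemma raise_X_mul (i : Fin N) (f : MvPolynomial (Fin N) K) :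
    raise (X i * f) = X (rot.symm i) * raise f := by
  rw [raise_apply, raise_apply, map_mul, rename_X]
  ring

lemma weight_rot {α : K} (hα : α ≠ 0) {I : Finset (Fin N)} (hI : I.Nonempty) (η : Fin N → ℕ)
    (j : Fin N) : weight α (I.map rot.symm.toEmbedding) (phi η) (spec α (phi η)) j =
      weight α I η (spec α η) (rot j) := by
  rw [weight, spec_phi hα, phi_eq_rotFun, succVal_rot hI, succVal_rot hI, weight]
  simp only [mem_map_rot, rotFun, fa, fb, add_left_inj, add_sub_add_right_eq_sub]

/-- Each actual exchange in the sweep involves unequal entries, by the condition on the gaps, and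
such exchanges permute the spectral vector in the same way. -/
lemma spec_carry (α : K) (η : Fin N → ℕ)
    (p : Fin N) : ∀ I : Finset (Fin N), (∀ l ∈ I, p ≤ l) → top ∈ I →
      (∀ j ∈ Ico p top, j ∉ I → η j ≠ succVal I η j) →
      spec α (carry p I η) = carry p I (spec α η) := by
  induction p using top_induction with
  | h0 =>
    intro I hI htop _
    have : I = {top} := by
      ext l
      rw [mem_singleton]
      refine ⟨fun hl => ?_, fun h => h ▸ htop⟩
      by_contra hne
      exact absurd (hI l hl) (not_le.2 (lt_top' hne))
    rw [this, carry_top, carry_top]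
  | hs q p h ih =>
    intro I hI htop hmax
    have hqp : q < p := by rw [Fin.lt_def]; omega
    have hqt : q < top := lt_of_lt_of_le hqp (by
      have := p.isLt
      have := coe_top (N := N)
      rw [Fin.le_def]; omega)
    by_cases hq : q ∈ I
    · have hins : insert q (I.erase q) = I := Finset.insert_erase hq
      have hI' : ∀ l ∈ I.erase q, p ≤ l := fun l hl => by
        have h1 := hI l (mem_of_mem_erase hl)
        have h2 : (l : ℕ) ≠ q := fun h => ne_of_mem_erase hl (Fin.ext h)
        rw [Fin.le_def] at h1 ⊢
        omega
      have htop' : top ∈ I.erase q := mem_erase.2 ⟨hqt.ne', htop⟩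
      have := ih (I.erase q) hI' htop' (fun j hj hjI => by
        have hjq : j ≠ q := by rintro rfl; exact notMem_Ico_succ h hj
        rw [← succVal_insert h htop' η (mem_Ico.1 hj).1 (mem_Ico.1 hj).2, hins]
        exact hmax j (by rw [Ico_top_eq_insert h]; exact mem_insert_of_mem hj)
          fun hm => hjI (mem_erase.2 ⟨hjq, hm⟩))
      rw [← carry_insert h hI' htop', ← carry_insert h hI' htop', hins] at this
      exact this
    · have hI' : ∀ l ∈ I, p ≤ l := fun l hl => by
        have h1 := hI l hl
        have h2 : (l : ℕ) ≠ q := fun h => hq (by rwa [← Fin.ext h])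
        rw [Fin.le_def] at h1 ⊢
        omega
      have := ih I hI' htop (fun j hj hjI => hmax j (by
        rw [Ico_top_eq_insert h]; exact mem_insert_of_mem hj) hjI)
      have hne : carry p I η q ≠ carry p I η p := by
        rw [carry_of_lt hqp, carry_self, ← succVal_of_isNext (isNext_first h hI' ⟨_, htop⟩) η]
        exact hmax q (mem_Ico.2 ⟨le_rfl, hqt⟩) hq
      rw [carry_gap h hI', carry_gap h hI', spec_swap α h hne, this]

variable [CharZero K] {α : K}

/-- One step of the sweep. -/
lemma swap_jackN_carry (hα : ∀ m n : ℕ, 0 < m → (m : K) * α + (n : K) ≠ 0) (η : Fin N → ℕ)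
    {q p : Fin N} (h : (q : ℕ) + 1 = p) {T : Finset (Fin N)} (hT : T ⊆ Ico p top) :
    rename (Equiv.swap q p) ((∏ j ∈ Ico p top, weight α (insert top T) η (spec α η) j) •
      jackN α (carry p (insert top T) η)) =
    (∏ j ∈ Ico q top, weight α (insert top T) η (spec α η) j) •
      jackN α (carry q (insert top T) η) +
    (∏ j ∈ Ico q top, weight α (insert top (insert q T)) η (spec α η) j) •
      jackN α (carry q (insert top (insert q T)) η) := by
  have hα0 := ne_zero_of_generic hα
  have hqp : q < p := by rw [Fin.lt_def]; omega
  have hI := le_of_mem_insert_top hT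
  have htop : top ∈ insert top T := mem_insert_self _ _
  rw [Finset.insert_comm]
  generalize insert top T = I at hI htop
  have hqI : q ∉ I := fun hm => absurd (hI _ hm) (not_le.2 hqp)
  have hprod : ∏ j ∈ Ico p top, weight α (insert q I) η (spec α η) j =
      ∏ j ∈ Ico p top, weight α I η (spec α η) j := by
    refine Finset.prod_congr rfl fun j hj => ?_
    have hjq : j ≠ q := by rintro rfl; exact notMem_Ico_succ h hj
    rw [mem_Ico] at hj
    rw [weight, weight, succVal_insert h htop _ hj.1 hj.2, succVal_insert h htop _ hj.1 hj.2]
    simp only [mem_insert, hjq, false_or]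
  rw [Ico_top_eq_insert h, Finset.prod_insert (notMem_Ico_succ h),
    Finset.prod_insert (notMem_Ico_succ h), hprod]
  -- If the accumulated weight vanishes, so do all three terms. Otherwise no passed entry equals the
  -- carried one, which is what `spec_carry` needs.
  by_cases h0 : ∏ j ∈ Ico p top, weight α I η (spec α η) j = 0
  · rw [h0]; simp
  have hmax : ∀ j ∈ Ico p top, j ∉ I → η j ≠ succVal I η j := fun j hj hjI he => by
    apply h0
    refine Finset.prod_eq_zero hj ?_
    rw [weight, if_neg hjI, if_pos he]
  have hs := spec_carry α η p I hI htop hmax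
  have hn := isNext_first h hI ⟨_, htop⟩
  have hn' := isNext_insert_first h hI ⟨_, htop⟩
  -- The difference governing this transposition is read off the original spectral vector; then
  -- `δ⁻¹` is `a` and `1 + δ⁻¹` is `b`.
  have hd : etaBar α (carry p I η) q - etaBar α (carry p I η) p =
      α * (spec α η q - spec α η (first I)) := by
    have h1 := congrFun hs q
    have h2 := congrFun hs p
    rw [carry_of_lt hqp] at h1
    rw [carry_self] at h2
    rw [← h1, ← h2, spec, spec]
    field_simp
  have hne : spec α η (first I) - spec α η q ≠ 0 :=
    sub_ne_zero.2 ((spec_injective hα η).ne hn.2.1.ne')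
  have hw1 : weight α (insert q I) η (spec α η) q =
      (etaBar α (carry p I η) q - etaBar α (carry p I η) p)⁻¹ := by
    rw [weight, if_pos (mem_insert_self _ _), succVal_of_isNext hn', hd, fa, one_div]
  have hw2 : weight α I η (spec α η) q = if carry p I η q = carry p I η p then 0 else
      1 + (etaBar α (carry p I η) q - etaBar α (carry p I η) p)⁻¹ := by
    rw [weight, if_neg hqI, succVal_of_isNext hn, succVal_of_isNext hn, carry_of_lt hqp,
      carry_self, hd, fb, ← neg_sub (spec α η (first I)), mul_neg, inv_neg]
    congr 1
    field_simp
    ring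
  rw [map_smul, swap_jackN hα _ h, hw1, hw2, carry_gap h hI, carry_insert h hI htop, smul_add,
    smul_smul, smul_smul, mul_comm, add_comm, mul_comm]

/-- The permutation `w` is the cycle on the positions from `p` to `top`, built from adjacent
transpositions. Each transposition doubles the terms, and `T` records where the carried entry was
replaced. -/
lemma sweep (hα : ∀ m n : ℕ, 0 < m → (m : K) * α + (n : K) ≠ 0) (η : Fin N → ℕ) (p : Fin N) :
    ∃ w : Equiv.Perm (Fin N), w top = p ∧ (∀ j < p, w j = j) ∧ (∀ j, p ≤ j → j < top → w j = rot j) ∧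
      rename w (jackN α η) = ∑ T ∈ (Ico p top).powerset,
        (∏ j ∈ Ico p top, weight α (insert top T) η (spec α η) j) •
          jackN α (carry p (insert top T) η) := by
  induction p using top_induction with
  | h0 =>
    refine ⟨1, rfl, fun _ _ => rfl, fun j h1 h2 => absurd h2 (not_lt.2 h1), ?_⟩
    simp [carry_top]
  | hs q p h ih =>
    obtain ⟨w, h1, h2, h3, h4⟩ := ih
    have hqp : q < p := by rw [Fin.lt_def]; omega
    refine ⟨w.trans (Equiv.swap q p), by simp [h1], fun j hj => ?_, fun j hqj hj => ?_, ?_⟩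
    · rw [Equiv.trans_apply, h2 j (hj.trans hqp),
        Equiv.swap_apply_of_ne_of_ne hj.ne (hj.trans hqp).ne]
    · rw [Equiv.trans_apply]
      rcases eq_or_ne j q with rfl | hne
      · rw [h2 j hqp, Equiv.swap_apply_left, rot_eq_of_succ h]
      · have hr := coe_rot j
        have ht := coe_top (N := N)
        have hjq : (j : ℕ) ≠ q := fun h => hne (Fin.ext h)
        rw [Fin.lt_def] at hj
        rw [Fin.le_def] at hqj
        rw [if_neg (by omega)] at hr
        rw [h3 j (by rw [Fin.le_def]; omega) (by rw [Fin.lt_def]; omega),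
          Equiv.swap_apply_of_ne_of_ne]
        · rw [Ne, Fin.ext_iff]; omega
        · rw [Ne, Fin.ext_iff]; omega
    · rw [Equiv.coe_trans, ← rename_rename, h4, map_sum]
      rw [Ico_top_eq_insert h, Finset.sum_powerset_insert (notMem_Ico_succ h),
        ← Finset.sum_add_distrib, ← Ico_top_eq_insert h]
      exact Finset.sum_congr rfl fun T hT => swap_jackN_carry hα η h (mem_powerset.1 hT)

/-- The expansion of `z_i jackN` in the polynomials `jackN`. -/
def HasExpansion (α : K) (η : Fin N → ℕ) (i : Fin N) : Prop :=
  X i * jackN α η = ∑ I : Finset (Fin N) with i ∈ I,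
    (∏ j ∈ univ.erase i, weight α I η (spec α η) j) • jackN α (cI I η)

lemma univ_erase_top : univ.erase (top : Fin N) = Ico 0 top := by
  ext j
  simp only [mem_erase, mem_univ, and_true, mem_Ico, Fin.zero_le, true_and]
  exact ⟨lt_top', fun h => h.ne⟩

/-- At `p = 0` the sweep computes the full rotation, and raising the rotated polynomial multiplies
the original one by the last variable. -/
lemma hasExpansion_top (hα : ∀ m n : ℕ, 0 < m → (m : K) * α + (n : K) ≠ 0) (η : Fin N → ℕ) :
    HasExpansion α η top := by
  obtain ⟨w, h1, -, h3, h4⟩ := sweep hα η 0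
  have hw : w = rot := by
    ext j
    rcases eq_or_ne j top with rfl | hj
    · rw [h1, rot_top]
    · rw [h3 j (Fin.zero_le _) (lt_top' hj)]
  have h5 := congrArg raise h4
  rw [raise_apply, rename_rename, hw, Equiv.symm_comp_self, rename_id_apply, map_sum] at h5
  rw [HasExpansion, h5]
  have hsets : (univ.filter fun I : Finset (Fin N) => top ∈ I) =
      (Ico (0 : Fin N) top).powerset.image (insert top) := by
    ext I
    simp only [mem_filter, mem_univ, true_and, mem_image, mem_powerset]
    refine ⟨fun h => ⟨I.erase top, ?_, Finset.insert_erase h⟩, ?_⟩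
    · rw [← univ_erase_top]
      exact Finset.erase_subset_erase _ (subset_univ _)
    · rintro ⟨T, -, rfl⟩
      exact mem_insert_self _ _
  rw [hsets, Finset.sum_image, univ_erase_top]
  · refine Finset.sum_congr rfl fun T _ => ?_
    rw [map_smul, raise_jackN hα, phi_eq_rotFun, rotFun_carry_zero (mem_insert_self _ _),
      cI_eq_cycleFun]
  · intro S hS T hT h
    rw [Finset.mem_coe, mem_powerset, ← univ_erase_top] at hS hT
    have h1 : top ∉ S := fun h => by simpa using hS h
    have h2 : top ∉ T := fun h => by simpa using hT h
    rw [← Finset.erase_insert h1, h, Finset.erase_insert h2]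

/-- Raising is injective and turns the expansion for `i` and `η`, term by term, into the one for the
preceding index and `Φη`. Index `0` is thereby reduced to `top`, and each further index to the one
before it. -/
lemma HasExpansion.of_phi (hα : ∀ m n : ℕ, 0 < m → (m : K) * α + (n : K) ≠ 0) {η : Fin N → ℕ}
    {i : Fin N} (h : HasExpansion α (phi η) (rot.symm i)) : HasExpansion α η i := by
  rw [HasExpansion] at h ⊢
  apply raise_injective
  rw [raise_X_mul, raise_jackN hα, h, map_sum]
  refine (Finset.sum_equiv (Equiv.finsetCongr rot.symm) ?_ ?_).symm
  · intro I
    simp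
  · intro I hI
    have hi : i ∈ I := (mem_filter.1 hI).2
    rw [map_smul, raise_jackN hα, Equiv.finsetCongr_apply, cI_eq_cycleFun, cI_eq_cycleFun,
      phi_eq_rotFun, phi_eq_rotFun, cycleFun_rot ⟨i, hi⟩]
    congr 1
    refine Finset.prod_equiv rot.symm (by simp) fun j _ => ?_
    rw [← phi_eq_rotFun, weight_rot (ne_zero_of_generic hα) ⟨i, hi⟩, Equiv.apply_symm_apply]

lemma hasExpansion (hα : ∀ m n : ℕ, 0 < m → (m : K) * α + (n : K) ≠ 0) (η : Fin N → ℕ)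
    (i : Fin N) : HasExpansion α η i := by
  have key : ∀ n : ℕ, ∀ i : Fin N, (i : ℕ) = n → ∀ η : Fin N → ℕ, HasExpansion α η i := by
    intro n
    induction n with
    | zero =>
      intro i hi η
      have : i = 0 := Fin.ext (by rw [hi, coe_zero'])
      subst this
      exact HasExpansion.of_phi hα (hasExpansion_top hα _)
    | succ n ih =>
      intro i hi η
      have hlt := i.isLt
      have : rot.symm i = ⟨n, by omega⟩ := by
        rw [Equiv.symm_apply_eq]
        exact (rot_eq_of_succ (by simp [hi])).symm
      refine HasExpansion.of_phi hα ?_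
      rw [this]
      exact ih _ rfl _
  exact key i i rfl η

/-- The spectral vector of `c_I(η)`. -/
lemma spec_cycleFun (hα : ∀ m n : ℕ, 0 < m → (m : K) * α + (n : K) ≠ 0) {η : Fin N → ℕ}
    {I : Finset (Fin N)} (hI : I.Nonempty) (hmax : ∀ j ∉ I, η j ≠ succVal I η j) :
    spec α (cycleFun I η) = cycleFun I (spec α η) := by
  have hα0 := ne_zero_of_generic hα
  obtain ⟨i, hi⟩ := hI
  -- If `top ∈ I`, this is the end of the sweep. Any other `I` is rotated until it contains `top`;
  -- maximality and the claim itself are compatible with rotation.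
  have htop : ∀ (η : Fin N → ℕ) (I : Finset (Fin N)), top ∈ I →
      (∀ j ∉ I, η j ≠ succVal I η j) → spec α (cycleFun I η) = cycleFun I (spec α η) := by
    intro η I htop hmax
    rw [← rotFun_carry_zero htop, ← rotFun_carry_zero htop, ← phi_eq_rotFun, spec_phi hα0,
      spec_carry α η 0 I (fun _ _ => Fin.zero_le _) htop fun j _ => hmax j]
  have hstep : ∀ (η : Fin N → ℕ) (I : Finset (Fin N)), I.Nonempty →
      (∀ j ∉ I, η j ≠ succVal I η j) → ∀ j ∉ I.map rot.symm.toEmbedding,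
      phi η j ≠ succVal (I.map rot.symm.toEmbedding) (phi η) j := by
    intro η I hI hmax j hj
    rw [phi_eq_rotFun, succVal_rot hI, rotFun, Ne, add_left_inj]
    exact hmax _ (by rwa [mem_map_rot] at hj)
  have hback : ∀ (η : Fin N → ℕ) (I : Finset (Fin N)), I.Nonempty →
      spec α (cycleFun (I.map rot.symm.toEmbedding) (phi η)) =
        cycleFun (I.map rot.symm.toEmbedding) (spec α (phi η)) →
      spec α (cycleFun I η) = cycleFun I (spec α η) := by
    intro η I hI h
    rw [spec_phi hα0, phi_eq_rotFun, cycleFun_rot hI, cycleFun_rot hI, ← phi_eq_rotFun,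
      spec_phi hα0] at h
    exact rotFun_injective h
  have key : ∀ n : ℕ, ∀ i : Fin N, (i : ℕ) = n → ∀ (η : Fin N → ℕ) (I : Finset (Fin N)), i ∈ I →
      (∀ j ∉ I, η j ≠ succVal I η j) → spec α (cycleFun I η) = cycleFun I (spec α η) := by
    intro n
    induction n with
    | zero =>
      intro i hn η I hi hmax
      have : i = 0 := Fin.ext (by rw [hn, coe_zero'])
      subst this
      refine hback η I ⟨_, hi⟩ (htop _ _ ?_ (hstep η I ⟨_, hi⟩ hmax))
      rwa [mem_map_rot, rot_top]
    | succ n ih =>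
      intro i hn η I hi hmax
      have hlt := i.isLt
      refine hback η I ⟨_, hi⟩ (ih ⟨n, by omega⟩ rfl _ _ ?_ (hstep η I ⟨_, hi⟩ hmax))
      rwa [mem_map_rot, rot_eq_of_succ (p := i) (by simp [hn])]
  exact key i i rfl η I hi hmax

end Expansion

/-! ### Identification of the coefficients. -/

section Coefficients

variable {K : Type*} [Field K] {N : ℕ} [NeZero N]

lemma AI_eq (α : K) {I : Finset (Fin N)} (hI : I.Nonempty) (x : Fin N → K) :
    AI α I x = ∏ t ∈ I, fa α (x t) (succVal I x t) := by
  rw [AI, ← Finset.prod_erase_mul _ _ (last_mem hI), succVal_last]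
  congr 1
  · refine Finset.prod_congr rfl fun t ht => ?_
    rw [mem_erase] at ht
    rw [succVal_of_lt_last hI (lt_last_of_mem ht.2 ht.1)]
  · rw [fa, fa, sub_sub, add_comm (x (first I))]

/-- The gaps below the elements of `I` are the fibres of `next I` on the positions outside `I` and
before `last I`. -/
lemma BHat_eq (α : K) {I : Finset (Fin N)} (hI : I.Nonempty) (x : Fin N → K) :
    BHat α I x = ∏ j ∈ univ \ I, fb α (succVal I x j) (x j) := by
  have hsplit : univ \ I = ((univ \ I).filter (· < last I)) ∪ Ioi (last I) := by
    ext j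
    simp only [mem_sdiff, mem_univ, true_and, mem_union, mem_filter, mem_Ioi]
    refine ⟨fun h => ?_, ?_⟩
    · rcases lt_trichotomy j (last I) with h1 | rfl | h1
      · exact Or.inl ⟨h, h1⟩
      · exact absurd (last_mem hI) h
      · exact Or.inr h1
    · rintro (h | h)
      · exact h.1
      · exact fun hj => absurd (le_last hj) (not_le.2 h)
  have hdisj : Disjoint ((univ \ I).filter (· < last I)) (Ioi (last I)) := by
    rw [Finset.disjoint_left]
    intro j
    simp only [mem_filter, mem_Ioi]
    exact fun h h' => lt_asymm h.2 h'
  have hnext : ∀ j ∈ (univ \ I).filter (· < last I), IsNext I j (next I j) := fun j hj => by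
    obtain ⟨k, hk⟩ := exists_isNext (last_mem hI) (mem_filter.1 hj).2
    rwa [hk.next_eq]
  rw [BHat, hsplit, Finset.prod_union hdisj,
    ← Finset.prod_fiberwise_of_maps_to (fun j hj => (hnext j hj).1)]
  congr 1
  · refine Finset.prod_congr rfl fun t ht => ?_
    have : (((univ \ I).filter (· < last I)).filter fun j => next I j = t) = gapBelow I t := by
      ext j
      rw [mem_filter, gapBelow, mem_filter (s := Iio t), mem_Iio]
      refine ⟨?_, fun ⟨h1, h2⟩ => ?_⟩
      · rintro ⟨hj, rfl⟩
        have hn := hnext j hj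
        refine ⟨hn.2.1, fun k hk hkt => ?_⟩
        have hjk : k ≠ j := by
          rintro rfl
          exact (mem_sdiff.1 (mem_filter.1 hj).1).2 hk
        by_contra h
        exact absurd (hn.2.2 k hk (lt_of_le_of_ne (not_lt.1 h) hjk.symm)) (not_le.2 hkt)
      · have hn : IsNext I j t := ⟨ht, h1, fun l hl hjl => by
          by_contra h3
          exact lt_asymm hjl (h2 l hl (not_le.1 h3))⟩
        refine ⟨mem_filter.2 ⟨mem_sdiff.2 ⟨mem_univ _, fun hj => ?_⟩, ?_⟩, hn.next_eq⟩
        · exact lt_irrefl _ (h2 j hj h1)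
        · exact lt_of_lt_of_le h1 (le_last ht)
    rw [← this]
    refine Finset.prod_congr rfl fun j hj => ?_
    rw [mem_filter] at hj
    have hn := hnext j hj.1
    rw [succVal_of_isNext hn, hj.2]
  · refine Finset.prod_congr rfl fun j hj => ?_
    rw [succVal_of_forall_le fun l hl => (le_last hl).trans (mem_Ioi.1 hj).le]

lemma BTilde_eq (α : K) (I : Finset (Fin N)) (x : Fin N → K) :
    BTilde α I x = BHat α I x * (x (first I) + 1 + ((N : K) - 1) / α) := rfl

lemma chiTilde_eq (α : K) {I : Finset (Fin N)} {i : Fin N} (hi : i ∈ I) (x : Fin N → K) :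
    chiTilde α I i x = α * (x i - succVal I x i) := by
  rw [chiTilde]
  split_ifs with h
  · rw [h, succVal_last]; ring
  · rw [succVal_of_lt_last ⟨i, hi⟩ (lt_last_of_mem hi h)]

/-- The differences telescope around the cycle, and only the one added on closing it remains. -/
lemma sum_chiTilde (α : K) {I : Finset (Fin N)} (hI : I.Nonempty) (x : Fin N → K) :
    ∑ i ∈ I, chiTilde α I i x = -α := by
  have h := sum_cycleFun hI x id
  have h1 : ∑ j, cycleFun I x j = ∑ j ∈ univ \ I, x j + ∑ j ∈ I, succVal I x j := by
    rw [← Finset.sum_sdiff (subset_univ I)]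
    congr 1
    · exact Finset.sum_congr rfl fun j hj => by rw [cycleFun, if_neg (mem_sdiff.1 hj).2]
    · exact Finset.sum_congr rfl fun j hj => by rw [cycleFun, if_pos hj]
  simp only [id] at h
  rw [h1, ← Finset.sum_sdiff (subset_univ I) (f := x)] at h
  rw [Finset.sum_congr rfl fun i hi => chiTilde_eq α hi x, ← Finset.mul_sum,
    Finset.sum_sub_distrib]
  linear_combination (-α) * h

lemma prod_weight_eq_zero {α : K} {η : Fin N → ℕ}
    {I : Finset (Fin N)} (hI : ¬ IsMaximal η I) {i : Fin N} (hi : i ∈ I) :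
    ∏ j ∈ univ.erase i, weight α I η (spec α η) j = 0 := by
  rw [isMaximal_iff, not_and] at hI
  have := hI ⟨i, hi⟩
  push Not at this
  obtain ⟨j, hj, he⟩ := this
  refine Finset.prod_eq_zero (i := j) (mem_erase.2 ⟨?_, mem_univ _⟩) ?_
  · rintro rfl; exact hj hi
  · rw [weight, if_neg hj, if_pos he]

variable [CharZero K] {α : K}

lemma spec_sub_succVal_ne_zero (hα : ∀ m n : ℕ, 0 < m → (m : K) * α + (n : K) ≠ 0)
    (η : Fin N → ℕ) {I : Finset (Fin N)} {i : Fin N} (hi : i ∈ I) :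
    spec α η i - succVal I (spec α η) i ≠ 0 := by
  rw [sub_ne_zero]
  rcases isNext_or_forall_le I i with ⟨k, hk⟩ | hle
  · rw [succVal_of_isNext hk]
    exact (spec_injective hα η).ne hk.2.1.ne
  · rw [succVal_of_forall_le hle]
    intro h
    apply etaBar_ne_add hα η (first_le hi)
    have hα0 := ne_zero_of_generic hα
    rw [spec, spec] at h
    field_simp at h
    exact h

/-- The product over all positions is `A_I B̂_I`, and `χ̃` at `i` is the inverse of the omitted
weight. -/
lemma prod_weight (hα : ∀ m n : ℕ, 0 < m → (m : K) * α + (n : K) ≠ 0) {η : Fin N → ℕ}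
    {I : Finset (Fin N)} (hI : IsMaximal η I) {i : Fin N} (hi : i ∈ I) :
    ∏ j ∈ univ.erase i, weight α I η (spec α η) j =
      chiTilde α I i (spec α η) * AI α I (spec α η) * BHat α I (spec α η) := by
  rw [isMaximal_iff] at hI
  have h1 := Finset.mul_prod_erase univ (weight α I η (spec α η)) (mem_univ i)
  have h2 : ∏ j, weight α I η (spec α η) j = BHat α I (spec α η) * AI α I (spec α η) := by
    rw [AI_eq α hI.1, BHat_eq α hI.1, ← Finset.prod_sdiff (subset_univ I)]
    congr 1
    · refine Finset.prod_congr rfl fun j hj => ?_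
      have hj := (mem_sdiff.1 hj).2
      rw [weight, if_neg hj, if_neg (hI.2 j hj)]
    · exact Finset.prod_congr rfl fun j hj => by rw [weight, if_pos hj]
  have h3 : chiTilde α I i (spec α η) * weight α I η (spec α η) i = 1 := by
    rw [chiTilde_eq α hi, weight, if_pos hi, fa]
    exact mul_one_div_cancel (mul_ne_zero (ne_zero_of_generic hα)
      (spec_sub_succVal_ne_zero hα η hi))
  rw [h2] at h1
  linear_combination (chiTilde α I i (spec α η)) * h1 -
    (∏ j ∈ univ.erase i, weight α I η (spec α η) j) * h3

/-- The pairs of entry and spectral value are permuted, except that the pair at `first I` has both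
components raised by one; `eFac_succ` gives the resulting factor. -/
lemma ePrime_cI (hα : ∀ m n : ℕ, 0 < m → (m : K) * α + (n : K) ≠ 0) {η : Fin N → ℕ}
    {I : Finset (Fin N)} (hI : IsMaximal η I) :
    ePrime α (cI I η) =
      α * (spec α η (first I) + 1 + ((N : K) - 1) / α) * ePrime α η := by
  have hα0 := ne_zero_of_generic hα
  have hI' := isMaximal_iff.1 hI
  have h := prod_cycleFun hI'.1 η (spec α η) (eFac N α)
  have h1 : ∏ j, eFac N α (η j) (spec α η j) = ePrime α η := (ePrime_eq hα0 η).symm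
  have h2 : ∏ j, eFac N α (cycleFun I η j) (cycleFun I (spec α η) j) = ePrime α (cI I η) := by
    rw [cI_eq_cycleFun, ePrime_eq hα0, ← spec_cycleFun hα hI'.1 hI'.2]
    rfl
  have h3 : eFac N α (η (first I)) (spec α η (first I)) ≠ 0 := by
    have := ePrime_ne_zero hα η
    rw [← h1] at this
    exact Finset.prod_ne_zero_iff.1 this _ (mem_univ _)
  rw [h1, h2, eFac_succ] at h
  apply mul_right_cancel₀ h3
  linear_combination h

lemma BHat_eq_BTilde (hα : ∀ m n : ℕ, 0 < m → (m : K) * α + (n : K) ≠ 0) {η : Fin N → ℕ}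
    {I : Finset (Fin N)} (hI : IsMaximal η I) :
    BHat α I (spec α η) =
      α * (ePrime α η / ePrime α (cI I η)) * BTilde α I (spec α η) := by
  have h0 := ePrime_ne_zero hα η
  have h1 := ePrime_ne_zero hα (cI I η)
  have h2 := ePrime_cI hα hI
  rw [BTilde_eq, mul_assoc, ← mul_div_right_comm, ← mul_div_assoc, eq_div_iff h1, h2]
  ring

/-- The expansion of `z_i E_η`, with coefficients written with `B̂_I`. -/
lemma X_mul_jackE (hα : ∀ m n : ℕ, 0 < m → (m : K) * α + (n : K) ≠ 0) (η : Fin N → ℕ)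
    (i : Fin N) : X i * jackE α η =
      ∑ I ∈ maximalSets η with i ∈ I,
        (dPrime α η * ePrime α (cI I η) / (dPrime α (cI I η) * ePrime α η) *
          (chiTilde α I i (spec α η) * AI α I (spec α η) * BHat α I (spec α η))) •
            jackE α (cI I η) := by
  have hd := dPrime_ne_zero hα η
  have he := ePrime_ne_zero hα η
  have h1 : jackE α η = (dPrime α η / ePrime α η) • jackN α η := by
    rw [jackN, smul_smul, div_mul_div_cancel₀ he, div_self hd, one_smul]
  have h := hasExpansion hα η i
  rw [HasExpansion] at h
  rw [h1, mul_smul_comm, h, Finset.smul_sum]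
  symm
  have hsub : ((maximalSets η).filter fun I => i ∈ I) ⊆
      (univ.filter fun I : Finset (Fin N) => i ∈ I) := by
    intro I hI
    exact mem_filter.2 ⟨mem_univ _, (mem_filter.1 hI).2⟩
  refine Finset.sum_subset_zero_on_sdiff hsub ?_ ?_
  · intro I hI
    rw [mem_sdiff, mem_filter, mem_filter, maximalSets, mem_filter] at hI
    rw [prod_weight_eq_zero (fun hm => hI.2 ⟨⟨mem_univ _, hm⟩, hI.1.2⟩) hI.1.2, zero_smul,
      smul_zero]
  · intro I hI
    rw [mem_filter, maximalSets, mem_filter] at hI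
    rw [prod_weight hα hI.1.2 hI.2, jackN, smul_smul, smul_smul]
    congr 1
    have hd' := dPrime_ne_zero hα (cI I η)
    field_simp

lemma mem_maximalSets {η : Fin N → ℕ} {I : Finset (Fin N)} :
    I ∈ maximalSets η ↔ IsMaximal η I := by simp [maximalSets]

lemma coeff_eq_of_sum_eq (hα : ∀ m n : ℕ, 0 < m → (m : K) * α + (n : K) ≠ 0) {η : Fin N → ℕ}
    {S : Finset (Finset (Fin N))} {g : Finset (Fin N) → K} {c : (Fin N → ℕ) →₀ K}
    (h : c.sum (fun ν r => r • jackE α ν) = ∑ I ∈ S, g I • jackE α (cI I η)) (ν : Fin N → ℕ) :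
    c ν = ∑ I ∈ S with cI I η = ν, g I := by
  have h1 : c - ∑ I ∈ S, Finsupp.single (cI I η) (g I) = 0 := by
    apply sum_jackE_eq_zero hα
    rw [Finsupp.sum_sub_index fun _ _ _ => sub_smul _ _ _, h, sub_eq_zero,
      ← Finsupp.sum_finsetSum_index (h := fun ν r => r • jackE α ν) (fun _ => zero_smul _ _)
        fun _ _ _ => add_smul _ _ _]
    exact Finset.sum_congr rfl fun I _ => by
      rw [Finsupp.sum_single_index (h := fun ν r => r • jackE α ν) (zero_smul _ _)]
  rw [sub_eq_zero.1 h1, Finsupp.finsetSum_apply, Finset.sum_filter]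
  exact Finset.sum_congr rfl fun I _ => by rw [Finsupp.single_apply]

end Coefficients

end NonsymJack
-- The theorem.
open NonsymJack in
theorem mainTheorem2 {K : Type*} [Field K] [CharZero K] (α : K)
    (hα : ∀ m n : ℕ, 0 < m → (m : K) * α + (n : K) ≠ 0)
    {N : ℕ} [NeZero N] :
    -- the polynomials `E_η` are well defined
    (∀ η : Fin N → ℕ, ∃! P : MvPolynomial (Fin N) K, IsNonsymJack α η P) ∧
    ∀ (η : Fin N → ℕ) (x : Fin N → K), (∀ k, x k = etaBar α η k / α) →
      -- the expansion of `z_i E_η`, written with `B̂_I`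
      (∀ i : Fin N, X i * jackE α η =
        (dPrime α η / ePrime α η) • ∑ I ∈ maximalSets η with i ∈ I,
          (ePrime α (cI I η) * chiTilde α I i x * AI α I x * BHat α I x / dPrime α (cI I η)) •
            jackE α (cI I η)) ∧
      -- the two expressions for `B̂_I` agree
      (∀ I ∈ maximalSets η,
        BHat α I x = α * (ePrime α η / ePrime α (cI I η)) * BTilde α I x) ∧
      -- the expansion of `z_i E_η`, written with `B̃_I`
      (∀ i : Fin N, X i * jackE α η =
        (α * dPrime α η) • ∑ I ∈ maximalSets η with i ∈ I,
          (chiTilde α I i x * AI α I x * BTilde α I x / dPrime α (cI I η)) •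
            jackE α (cI I η)) ∧
      -- the coefficients in the expansion of `z_j E_η` in the polynomials `E_ν`
      (∀ (j : Fin N) (c : (Fin N → ℕ) →₀ K),
        X j * jackE α η = c.sum (fun ν r => r • jackE α ν) →
          (∀ I ∈ maximalSets η, j ∈ I →
            c (cI I η) = dPrime α η * ePrime α (cI I η) / (dPrime α (cI I η) * ePrime α η) *
                (chiTilde α I j x * AI α I x * BHat α I x) ∧
            dPrime α (cI I η) * ePrime α η / (dPrime α η * ePrime α (cI I η)) * c (cI I η) =
              chiTilde α I j x * AI α I x * BHat α I x) ∧
          (∀ ν : Fin N → ℕ, (¬ ∃ I ∈ maximalSets η, j ∈ I ∧ ν = cI I η) → c ν = 0)) ∧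
      -- the Pieri formula for `p = 1`
      (∑ i : Fin N, X i) * jackE α η =
        (-α ^ 2 * dPrime α η) • ∑ I ∈ maximalSets η,
          (AI α I x * BTilde α I x / dPrime α (cI I η)) • jackE α (cI I η) := by
  refine ⟨existsUnique_isNonsymJack hα, fun η x hx => ?_⟩
  obtain rfl : x = spec α η := funext hx
  have hα0 := ne_zero_of_generic hα
  have he := ePrime_ne_zero (N := N) hα
  have hd := dPrime_ne_zero (N := N) hα
  have hX := X_mul_jackE hα η
  have hB : ∀ I ∈ maximalSets η, _ := fun I hI => BHat_eq_BTilde hα (mem_maximalSets.1 hI)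
  have hX' : ∀ i : Fin N, X i * jackE α η =
      (α * dPrime α η) • ∑ I ∈ maximalSets η with i ∈ I,
        (chiTilde α I i (spec α η) * AI α I (spec α η) * BTilde α I (spec α η) /
          dPrime α (cI I η)) • jackE α (cI I η) := by
    intro i
    rw [hX, Finset.smul_sum]
    refine Finset.sum_congr rfl fun I hI => ?_
    have h1 := he η
    have h2 := he (cI I η)
    have h3 := hd (cI I η)
    rw [smul_smul, hB I (mem_filter.1 hI).1]
    congr 1
    field_simp
  refine ⟨fun i => ?_, hB, hX', fun j c hc => ⟨fun I hI hjI => ?_, fun ν hν => ?_⟩, ?_⟩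
  · rw [hX, Finset.smul_sum]
    refine Finset.sum_congr rfl fun I _ => ?_
    rw [smul_smul]
    congr 1
    have h1 := he η
    have h3 := hd (cI I η)
    field_simp
  · have h1 := coeff_eq_of_sum_eq hα (hc.symm.trans (hX j)) (cI I η)
    -- Injectivity of `c_I` on maximal sets leaves a single contribution.
    have h2 : (((maximalSets η).filter fun J => j ∈ J).filter fun J => cI J η = cI I η) = {I} := by
      ext J
      simp only [mem_filter, mem_singleton, mem_maximalSets]
      refine ⟨fun h => cI_injOn h.1.1 (mem_maximalSets.1 hI) h.2, ?_⟩
      rintro rfl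
      exact ⟨⟨mem_maximalSets.1 hI, hjI⟩, rfl⟩
    rw [h2, Finset.sum_singleton] at h1
    refine ⟨h1, ?_⟩
    rw [h1]
    have h3 := he η
    have h4 := he (cI I η)
    have h5 := hd η
    have h6 := hd (cI I η)
    field_simp
  · rw [coeff_eq_of_sum_eq hα (hc.symm.trans (hX j)) ν]
    refine Finset.sum_eq_zero fun I hI => absurd ?_ hν
    rw [mem_filter, mem_filter] at hI
    exact ⟨I, hI.1.1, hI.1.2, hI.2.symm⟩
  -- After interchanging the sums, each `I` carries `∑_{i ∈ I} χ̃ = -α`; with the prefactor `α` this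
  -- gives `-α²`.
  · rw [Finset.sum_mul, Finset.sum_congr rfl fun i _ => hX' i, ← Finset.smul_sum,
      Finset.sum_comm' (t' := maximalSets η) (s' := fun I => I)
        (by simp only [mem_univ, mem_filter, true_and]; tauto), Finset.smul_sum, Finset.smul_sum]
    refine Finset.sum_congr rfl fun I hI => ?_
    rw [← Finset.sum_smul, smul_smul, smul_smul, ← Finset.sum_div, ← Finset.sum_mul,
      ← Finset.sum_mul, sum_chiTilde α (mem_maximalSets.1 hI).1]
    congr 1
    ring
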